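/- Let $K$ be a field of characteristic zero, let $n\ge 1$, and let $[1,n]=I_1\sqcup\dots\sqcup I_\ell$ be a partition of $[1,n]=\{1,\dots,n\}$ into consecutive non-empty segments. Let $P$ be the corresponding parabolic subgroup of block upper triangular matrices in $\mathrm{SL}(n)$, and let $U$ be its unipotent radical, i.e. the group of all matrices $E+A$ such that $A=(a_{st})$ over $K$ has $a_{st}=0$ unless $s\in I_k$, $t\in I_m$ with $k<m$. The group $U$ acts on the coordinate ring $K[\mathrm{SL}(n)]=K[x_{ij}]/(\det \mathbb X-1)$, where $\mathbb X=(x_{ij})_{i,j=1}^n$, by $(\rho(g)f)(x)=f(g^{-1}xg)$, and hence on the field $\mathcal F=K(\mathrm{SL}(n))$ of rational functions. For $i\in[1,n]$ put $i'=n+1-i$. Let $\mathbb S$ be the set of pairs $(i,j)\in[1,n]^2$ such that $i\in I_k$ and $j'\in I_m$ with $k\ge m$. Let $\mathbb X^*$ be the adjugate matrix of $\mathbb X$. For $(i,j)\in\mathbb S$ define $\mathcal J_{ij}\in K[x_{st}]$ as follows. * If $i\le j'$, then $\mathcal J_{ij}$ is the minor of $\mathbb X$ with columns $1,\dots,j$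 and rows $\{i\}\cup[j'+1,n]$. * If $i>j'$, then $\mathcal J_{ij}$ is the determinant of the $(j\times j)$-matrix whose first $i'$ rows are the last $i'$ rows of $\mathbb X$, and whose other $j-i'$ rows are the last $j-i'$ rows of $\mathbb X^*$, all restricted to the columns $1,\dots,j$ (in their natural order). Then the restrictions to $\mathrm{SL}(n)$ of the polynomials $\mathcal J_{ij}$ with $(i,j)\in\mathbb S$, $(i,j)\neq(1,n)$, freely generate the field of invariants $\mathcal F^U$ over $K$: they are algebraically independent over $K$, and $\mathcal F^U$ is the subfield of $\mathcal F$ that they generate over $K$. Moreover $(1,n)\in\mathbb S$, and the omitted polynomial is $\mathcal J_{1n}=\det\mathbb X$. -/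

import Mathlib

namespace UnipotentInvariants

open Matrix

noncomputable section

/-! ## The polynomials `J_ij`

Rows and columns are numbered from `0`, so that the position `(i, j)` of the `1`-based numbering is
`(i - 1, j - 1)` here, and the reflection `i' = n + 1 - i` is `Fin.rev i`. -/

variable {n : ℕ}

/-- The set of positions `(i, j)` with `i ∈ I_k`, `j ∈ (I_m)'` (that is, `j' ∈ I_m`) and `k ≥ m`,
where `I_1, I_2, …` are the consecutive blocks of the composition `c`. -/
def positions (c : Composition n) : Set (Fin n × Fin n) :=
  {p | c.index p.2.rev ≤ c.index p.1}

/-- The row `j' + r` for `r ≤ j` (in `0`-based numbering). As `r` runs through `1, …, j` these are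
the last `j` rows. -/
def lastRow (j : Fin n) (r : Fin (j.val + 1)) : Fin n :=
  ⟨j.rev.val + r.val, by have := r.isLt; have := j.isLt; simp only [Fin.val_rev]; omega⟩

/-- The column `c ≤ j`. -/
def firstCol (j : Fin n) (c : Fin (j.val + 1)) : Fin n :=
  Fin.castLE j.isLt c

/-- The square submatrix of `X` on the columns `≤ j` and the rows `{i} ∪ {s | s > j'}`. -/
def minorMatrix {R : Type*} (X : Matrix (Fin n) (Fin n) R) (i j : Fin n) :
    Matrix (Fin (j.val + 1)) (Fin (j.val + 1)) R :=
  X.submatrix (fun r => if r.val = 0 then i else lastRow j r) (firstCol j)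

/-- The matrix `Y_ij`: on the columns `≤ j`, first the last `n - i` rows of `X` (the rows
`i, i + 1, …` in `0`-based numbering), and below them as many of the last rows of the adjugate
matrix of `X` as are needed to make the matrix square. -/
def stackedMatrix {R : Type*} [CommRing R] (X : Matrix (Fin n) (Fin n) R) (i j : Fin n) :
    Matrix (Fin (j.val + 1)) (Fin (j.val + 1)) R :=
  Matrix.of fun r c =>
    if h : i.val + r.val < n then X ⟨i.val + r.val, h⟩ (firstCol j c)
    else X.adjugate (lastRow j r) (firstCol j c)

/-- The polynomial `J_ij` in the entries of the generic matrix: a minor if `(i, j)` is on or above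
the anti-diagonal (`i ≤ j'`), and `det Y_ij` if it is strictly below. -/
def J (K : Type*) [Field K] (i j : Fin n) : MvPolynomial (Fin n × Fin n) K :=
  if i ≤ j.rev then (minorMatrix (mvPolynomialX (Fin n) (Fin n) K) i j).det
  else (stackedMatrix (mvPolynomialX (Fin n) (Fin n) K) i j).det

/-! ## The unipotent radical -/

/-- The unipotent radical of the parabolic subgroup of `SL(n)` of block upper triangular matrices
with diagonal blocks given by `c`: the matrices `E + A`, where `A` has non-zero entries only at
positions in `I_k × I_m` with `k < m`. -/
def unipotentRadical (K : Type*) [Field K] (c : Composition n) :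
    Subgroup (SpecialLinearGroup (Fin n) K) where
  carrier := {g | ∀ i j, c.index j ≤ c.index i →
    (g : Matrix (Fin n) (Fin n) K) i j = (1 : Matrix (Fin n) (Fin n) K) i j}
  one_mem' := by intro i j _; simp
  mul_mem' := by
    intro g h hg hh i j hij
    change ((g : Matrix (Fin n) (Fin n) K) * (h : Matrix (Fin n) (Fin n) K)) i j = _
    rw [Matrix.mul_apply]
    have key : ∀ k, (g : Matrix (Fin n) (Fin n) K) i k * (h : Matrix (Fin n) (Fin n) K) k j
        = (1 : Matrix (Fin n) (Fin n) K) i k * (1 : Matrix (Fin n) (Fin n) K) k j := by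
      intro k
      rcases le_total (c.index k) (c.index i) with h1 | h1
      · rw [hg i k h1]
        by_cases hik : i = k
        · subst hik; rw [hh i j hij]
        · simp [Matrix.one_apply_ne hik]
      · rw [hh k j (hij.trans h1)]
        by_cases hkj : k = j
        · subst hkj; rw [hg i k hij]
        · simp [Matrix.one_apply_ne hkj]
    rw [Finset.sum_congr rfl fun k _ => key k, ← Matrix.mul_apply, one_mul]
  inv_mem' := by
    intro g hg i j hij
    have htri : (g : Matrix (Fin n) (Fin n) K).BlockTriangular c.index := by
      intro i j hlt
      rw [hg i j hlt.le, Matrix.one_apply_ne]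
      rintro rfl
      exact lt_irrefl _ hlt
    have hmul : ((g⁻¹ : SpecialLinearGroup (Fin n) K) : Matrix (Fin n) (Fin n) K) *
        (g : Matrix (Fin n) (Fin n) K) = 1 :=
      congrArg Subtype.val (inv_mul_cancel g)
    have hmul' : (g : Matrix (Fin n) (Fin n) K) *
        ((g⁻¹ : SpecialLinearGroup (Fin n) K) : Matrix (Fin n) (Fin n) K) = 1 :=
      congrArg Subtype.val (mul_inv_cancel g)
    have : Invertible (g : Matrix (Fin n) (Fin n) K) := ⟨_, hmul, hmul'⟩
    have hinv : (((g⁻¹ : SpecialLinearGroup (Fin n) K) : Matrix (Fin n) (Fin n) K)).BlockTriangular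
        c.index := by
      have h := blockTriangular_inv_of_blockTriangular htri
      rwa [Matrix.inv_eq_left_inv hmul] at h
    change ((g⁻¹ : SpecialLinearGroup (Fin n) K) : Matrix (Fin n) (Fin n) K) i j = _
    rw [← hmul, Matrix.mul_apply, Finset.sum_eq_single j]
    · rw [hg j j le_rfl, Matrix.one_apply_eq, mul_one]
    · intro k _ hkj
      rcases lt_or_ge (c.index k) (c.index i) with h1 | h1
      · rw [hinv h1, zero_mul]
      · rw [hg k j (hij.trans h1), Matrix.one_apply_ne hkj, mul_zero]
    · simp

/-! ## The coordinate ring of `SL(n)` and its field of rational functions -/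

section coordinateRing

variable (K : Type*) [Field K] (n)

/-- The coordinate ring `K[SL(n)] = K[x_ij] / (det X - 1)`. -/
abbrev CoordRing : Type _ :=
  MvPolynomial (Fin n × Fin n) K ⧸
    Ideal.span {(mvPolynomialX (Fin n) (Fin n) K).det - 1}

/-- The generic matrix of `SL(n)`, whose entries are the coordinate functions. -/
def genericMatrix : Matrix (Fin n) (Fin n) (CoordRing n K) :=
  (mvPolynomialX (Fin n) (Fin n) K).map
    (Ideal.Quotient.mk (Ideal.span {(mvPolynomialX (Fin n) (Fin n) K).det - 1}))

theorem det_genericMatrix : (genericMatrix n K).det = 1 := by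
  have h : (Ideal.Quotient.mk (Ideal.span {(mvPolynomialX (Fin n) (Fin n) K).det - 1}))
      ((mvPolynomialX (Fin n) (Fin n) K).det) = 1 := by
    rw [← map_one (Ideal.Quotient.mk (Ideal.span {(mvPolynomialX (Fin n) (Fin n) K).det - 1})),
      Ideal.Quotient.eq]
    exact Ideal.subset_span rfl
  rw [← h, RingHom.map_det]
  rfl

variable {n K}

/-- A matrix of determinant `1` over a `K`-algebra `R` is an `R`-valued point of `SL(n)`. -/
def evalAt {R : Type*} [CommRing R] [Algebra K R] (M : Matrix (Fin n) (Fin n) R) (hM : M.det = 1) :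
    CoordRing n K →ₐ[K] R :=
  Ideal.Quotient.liftₐ _ (MvPolynomial.aeval fun p : Fin n × Fin n => M p.1 p.2) (by
    intro a ha
    have hle : Ideal.span {(mvPolynomialX (Fin n) (Fin n) K).det - 1} ≤
        RingHom.ker (MvPolynomial.aeval (R := K) fun p : Fin n × Fin n => M p.1 p.2) := by
      rw [Ideal.span_singleton_le_iff_mem, RingHom.mem_ker, map_sub, map_one, AlgHom.map_det,
        mvPolynomialX_mapMatrix_aeval, hM, sub_self]
    exact hle ha)

theorem evalAt_genericMatrix {R : Type*} [CommRing R] [Algebra K R]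
    (M : Matrix (Fin n) (Fin n) R) (hM : M.det = 1) (i j : Fin n) :
    evalAt (K := K) M hM (genericMatrix n K i j) = M i j := by
  have : genericMatrix n K i j = Ideal.Quotient.mk _ (MvPolynomial.X (i, j)) := rfl
  rw [this]
  unfold evalAt
  erw [Ideal.Quotient.liftₐ_apply, Ideal.Quotient.lift_mk]
  simp

theorem algHom_ext' {R : Type*} [CommRing R] [Algebra K R] {f g : CoordRing n K →ₐ[K] R}
    (h : ∀ i j, f (genericMatrix n K i j) = g (genericMatrix n K i j)) : f = g := by
  apply Ideal.Quotient.algHom_ext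
  apply MvPolynomial.algHom_ext
  rintro ⟨i, j⟩
  exact h i j

/-- `K[SL(n)]` is a domain: it embeds into `K[GL(n)]`, through the map which divides the first row
of an invertible matrix by its determinant. -/
instance : IsDomain (CoordRing n K) := by
  let X := mvPolynomialX (Fin n) (Fin n) K
  let L := Localization.Away X.det
  have hne : X.det ≠ 0 := det_mvPolynomialX_ne_zero (Fin n) K
  have : IsDomain L := IsLocalization.isDomain_localization
    (powers_le_nonZeroDivisors_of_noZeroDivisors hne)
  let d : L := IsLocalization.Away.invSelf X.det
  have hd : algebraMap _ L X.det * d = 1 := IsLocalization.Away.mul_invSelf X.det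
  let v : Fin n → L := fun i => if i.val = 0 then d else 1
  let M : Matrix (Fin n) (Fin n) L :=
    Matrix.of fun i j => v i * (X.map (algebraMap _ L)) i j
  have hM : M.det = 1 := by
    have h1 : M.det = (∏ i, v i) * (X.map (algebraMap _ L)).det := Matrix.det_mul_column v _
    have h2 : (X.map (algebraMap _ L)).det = algebraMap _ L X.det :=
      ((algebraMap _ L).map_det X).symm
    rw [h1, h2]
    rcases Nat.eq_zero_or_pos n with hn | hn
    · subst hn; simp
    · rw [Finset.prod_eq_single (⟨0, hn⟩ : Fin n)]
      · simp only [v, if_true]; rw [mul_comm]; exact hd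
      · intro b _ hb
        have : b.val ≠ 0 := fun h => hb (Fin.ext h)
        simp [v, this]
      · simp
  let φ : CoordRing n K →ₐ[K] L := evalAt M hM
  let q : MvPolynomial (Fin n × Fin n) K →+* CoordRing n K := Ideal.Quotient.mk _
  have hq : q X.det = 1 := by
    rw [← det_genericMatrix n K, RingHom.map_det]; rfl
  have hu : IsUnit (q X.det) := by rw [hq]; exact isUnit_one
  let ψ : L →+* CoordRing n K := IsLocalization.Away.lift X.det hu
  have hψ : ∀ a, ψ (algebraMap _ L a) = q a := fun a => IsLocalization.Away.lift_eq X.det hu a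
  have hψd : ψ d = 1 := by
    have := congrArg ψ hd
    rwa [map_mul, map_one, hψ, hq, one_mul] at this
  let ψ' : L →ₐ[K] CoordRing n K :=
    { ψ with
      commutes' := fun r => by
        have : algebraMap K L r = algebraMap _ L (MvPolynomial.C r) :=
          IsScalarTower.algebraMap_apply K (MvPolynomial (Fin n × Fin n) K) L r
        rw [this]
        exact hψ _ }
  have hcomp : ψ'.comp φ = AlgHom.id K _ := by
    apply algHom_ext'
    intro i j
    have h1 : φ (genericMatrix n K i j) = M i j := evalAt_genericMatrix M hM i j
    have h2 : ψ (v i) = 1 := by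
      by_cases h : i.val = 0
      · simp only [v, h, if_true]; exact hψd
      · simp [v, h]
    have h3 : ψ (M i j) = genericMatrix n K i j := by
      change ψ (v i * algebraMap _ L (X i j)) = _
      rw [map_mul, h2, one_mul, hψ]
      rfl
    rw [AlgHom.comp_apply, h1]
    exact h3
  have hinj : Function.Injective φ := by
    intro a b hab
    have := congrArg ψ' hab
    rwa [← AlgHom.comp_apply, ← AlgHom.comp_apply, hcomp] at this
  exact hinj.isDomain φ.toRingHom

/-- The field `K(SL(n))` of rational functions on `SL(n)`. -/
abbrev SLFunctionField (n : ℕ) (K : Type*) [Field K] : Type _ := FractionRing (CoordRing n K)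

/-! ## The action by conjugation -/

/-- The conjugate `g⁻¹ X g` of the generic matrix. -/
def conjMatrix (g : SpecialLinearGroup (Fin n) K) : Matrix (Fin n) (Fin n) (CoordRing n K) :=
  ((g⁻¹ : SpecialLinearGroup (Fin n) K) : Matrix (Fin n) (Fin n) K).map
      (algebraMap K (CoordRing n K)) *
    genericMatrix n K * (g : Matrix (Fin n) (Fin n) K).map (algebraMap K (CoordRing n K))

theorem det_conjMatrix (g : SpecialLinearGroup (Fin n) K) : (conjMatrix g).det = 1 := by
  have h : ∀ g : SpecialLinearGroup (Fin n) K,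
      ((g : Matrix (Fin n) (Fin n) K).map (algebraMap K (CoordRing n K))).det = 1 := by
    intro g
    have := (algebraMap K (CoordRing n K)).map_det (g : Matrix (Fin n) (Fin n) K)
    rw [g.det_coe, map_one] at this
    exact this.symm
  rw [conjMatrix, Matrix.det_mul, Matrix.det_mul, h, h, det_genericMatrix]
  simp

/-- The representation of `SL(n)` on `K[SL(n)]` given by `(ρ(g) f)(x) = f(g⁻¹ x g)`. -/
def conjHom : SpecialLinearGroup (Fin n) K →* (CoordRing n K →ₐ[K] CoordRing n K) where
  toFun g := evalAt (conjMatrix g) (det_conjMatrix g)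
  map_one' := by
    apply algHom_ext'
    intro i j
    rw [evalAt_genericMatrix]
    simp [conjMatrix]
  map_mul' g h := by
    apply algHom_ext'
    intro i j
    have key : ((conjMatrix h).map (evalAt (K := K) (conjMatrix g) (det_conjMatrix g))) =
        conjMatrix (g * h) := by
      have hc : ∀ A : Matrix (Fin n) (Fin n) K,
          (A.map (algebraMap K (CoordRing n K))).map
            (evalAt (K := K) (conjMatrix g) (det_conjMatrix g)) =
          A.map (algebraMap K (CoordRing n K)) := by
        intro A; ext i j
        simp only [Matrix.map_apply, AlgHom.commutes]
      have hg : (genericMatrix n K).map (evalAt (K := K) (conjMatrix g) (det_conjMatrix g)) =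
          conjMatrix g := by
        ext i j
        rw [Matrix.map_apply, evalAt_genericMatrix]
      conv_lhs => rw [conjMatrix]
      rw [Matrix.map_mul, Matrix.map_mul, hc, hc, hg]
      have h1 : (((g * h)⁻¹ : SpecialLinearGroup (Fin n) K) : Matrix (Fin n) (Fin n) K) =
          ((h⁻¹ : SpecialLinearGroup (Fin n) K) : Matrix (Fin n) (Fin n) K) *
          ((g⁻¹ : SpecialLinearGroup (Fin n) K) : Matrix (Fin n) (Fin n) K) :=
        congrArg Subtype.val (_root_.mul_inv_rev g h)
      have h2 : ((g * h : SpecialLinearGroup (Fin n) K) : Matrix (Fin n) (Fin n) K) =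
          (g : Matrix (Fin n) (Fin n) K) * (h : Matrix (Fin n) (Fin n) K) := rfl
      simp only [conjMatrix]
      rw [h1, h2, Matrix.map_mul, Matrix.map_mul]
      simp only [Matrix.mul_assoc]
    rw [evalAt_genericMatrix, ← key, AlgHom.mul_apply, evalAt_genericMatrix, Matrix.map_apply]

/-- The same action, by automorphisms. -/
def conjAut : SpecialLinearGroup (Fin n) K →* (CoordRing n K ≃ₐ[K] CoordRing n K) :=
  (AlgEquiv.algHomUnitsEquiv K (CoordRing n K)).toMonoidHom.comp
    (conjHom (n := n) (K := K)).toHomUnits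

theorem conjAut_genericMatrix (g : SpecialLinearGroup (Fin n) K) (i j : Fin n) :
    conjAut g (genericMatrix n K i j) = conjMatrix g i j :=
  evalAt_genericMatrix (conjMatrix g) (det_conjMatrix g) i j

/-- The action extended to the field of rational functions. -/
def conjRat : SpecialLinearGroup (Fin n) K →* (SLFunctionField n K ≃ₐ[K] SLFunctionField n K) :=
  (IsFractionRing.fieldEquivOfAlgEquivHom K (SLFunctionField n K)).comp conjAut

/-- The field `K(SL(n))^U` of rational functions that are invariant under the unipotent radical
of the parabolic subgroup given by `c`. -/
def invariantField (K : Type*) [Field K] (c : Composition n) : IntermediateField K (SLFunctionField n K) :=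
  IntermediateField.fixedField ((unipotentRadical K c).map conjRat)

/-- The polynomial `J_ij`, restricted to `SL(n)`, as a rational function on `SL(n)`. -/
def JRat (K : Type*) [Field K] (i j : Fin n) : SLFunctionField n K :=
  algebraMap (CoordRing n K) (SLFunctionField n K) (Ideal.Quotient.mk _ (J K i j))

end coordinateRing

end

end UnipotentInvariants

namespace UnipotentInvariants

open Matrix

/-! ## Invariance of the determinants under unitriangular conjugation -/

section invariance

variable {n : ℕ} {R : Type*} [CommRing R]

/-! Write `b` for the block index and `X` for the generic matrix of determinant one. Conjugation by
a block unitriangular `g` acts on leading columns and trailing rows by unitriangular matrices. On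
`SL(n)` the adjugate is the inverse, so it is conjugated in the same way. This makes every `J_ij`
with `i ≥ j'` invariant. If `i < j'`, the extra row `i` of the minor could pick up rows between `i`
and `j'`, but it does not when `b j' ≤ b i`.

For generation, a canonical form is built. The coordinate flag and its image under `X` are
generically transverse enough to define an upper unitriangular `u` (`frame`), whose entries are
quotients of the minors with `i ≤ j'`, such that `Z = u⁻¹ X u` vanishes for `i < j'`. The entries of
`Z` are rational in the `J_ij` with `i ≥ j'`: for such a matrix the inverse vanishes for `i > j'`,
the stacked determinant splits into a minor on consecutive rows and columns times antidiagonal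
entries of the inverse, and expansion of these minors along the top row recovers `Z` entry by entry.
The block diagonal part `l` of `u` only involves the admissible minors, so `W = u l⁻¹` lies in the
unipotent radical over the function field, and `W⁻¹ X W = l Z l⁻¹` has entries in the field `L`
generated by the `J_ij` (`exists_blockUnitriangular_conj_mem`).

A rational invariant is invariant only under `K`-points of the radical, but these are Zariski dense
since `K` is infinite. Hence its value at `X` equals its value at `W⁻¹ X W`, which lies in `L`
(`invariantField_le_of_conj_mem`).

For independence, the entries of `W` above the blocks are added to the `J_ij`. Together they
generate the whole function field, because `X` is recovered from `W` and `W⁻¹ X W`. There are `n² -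
1` of them, one for each position other than `(1, n)`, and this is the transcendence degree, so they
are algebraically independent. -/

theorem det_eq_one_of_upperUnitriangular {m : Type*} [LinearOrder m] [Fintype m]
    {A : Matrix m m R} (h : ∀ s t, t ≤ s → A s t = (1 : Matrix m m R) s t) : A.det = 1 := by
  rw [det_of_isUpperTriangular]
  · exact Finset.prod_eq_one fun i _ => by rw [h i i le_rfl, one_apply_eq]
  · intro s t hst
    have hlt : t < s := hst
    exact (h s t hlt.le).trans (one_apply_ne hlt.ne')

theorem firstCol_injective (j : Fin n) : Function.Injective (firstCol j) :=
  Fin.castLE_injective j.isLt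

theorem lastRow_injective (j : Fin n) : Function.Injective (lastRow j) := by
  intro r s h
  simp only [lastRow, Fin.mk.injEq, Nat.add_left_cancel_iff] at h
  exact Fin.ext h

/-- The matrix whose first rows are the rows `i, i + 1, …` of `X`, and whose other rows are the
last rows of `Y`, on the columns `≤ j`. -/
def stackedPair (X Y : Matrix (Fin n) (Fin n) R) (i j : Fin n) :
    Matrix (Fin (j.val + 1)) (Fin (j.val + 1)) R :=
  Matrix.of fun r c =>
    if h : i.val + r.val < n then X ⟨i.val + r.val, h⟩ (firstCol j c)
    else Y (lastRow j r) (firstCol j c)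

theorem stackedMatrix_eq_stackedPair (X : Matrix (Fin n) (Fin n) R) (i j : Fin n) :
    stackedMatrix X i j = stackedPair X X.adjugate i j := rfl

theorem mul_apply_firstCol {B : Matrix (Fin n) (Fin n) R}
    (hB : ∀ s t, t ≤ s → B s t = (1 : Matrix (Fin n) (Fin n) R) s t)
    (X : Matrix (Fin n) (Fin n) R) (a j : Fin n) (c : Fin (j.val + 1)) :
    (X * B) a (firstCol j c) =
      ∑ s, X a (firstCol j s) * B (firstCol j s) (firstCol j c) := by
  rw [mul_apply]
  symm
  apply Fintype.sum_of_injective (firstCol j) (firstCol_injective j)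
  · intro t ht
    have hlt : firstCol j c < t := by
      by_contra hle
      apply ht
      refine ⟨⟨t.val, ?_⟩, rfl⟩
      have h1 : t.val ≤ c.val := not_lt.mp hle
      omega
    rw [hB _ _ hlt.le, one_apply_ne hlt.ne', mul_zero]
  · intro s; rfl

theorem det_firstCol_submatrix {B : Matrix (Fin n) (Fin n) R}
    (hB : ∀ s t, t ≤ s → B s t = (1 : Matrix (Fin n) (Fin n) R) s t) (j : Fin n) :
    (B.submatrix (firstCol j) (firstCol j)).det = 1 := by
  apply det_eq_one_of_upperUnitriangular
  intro s t hst
  rw [submatrix_apply, hB _ _ (show firstCol j t ≤ firstCol j s from hst)]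
  simp [one_apply, (firstCol_injective j).eq_iff]

theorem minorMatrix_mul_right {B : Matrix (Fin n) (Fin n) R}
    (hB : ∀ s t, t ≤ s → B s t = (1 : Matrix (Fin n) (Fin n) R) s t)
    (X : Matrix (Fin n) (Fin n) R) (i j : Fin n) :
    minorMatrix (X * B) i j =
      minorMatrix X i j * B.submatrix (firstCol j) (firstCol j) := by
  ext r c
  rw [minorMatrix, submatrix_apply, mul_apply_firstCol hB, mul_apply]
  rfl

theorem stackedPair_mul_right {B : Matrix (Fin n) (Fin n) R}
    (hB : ∀ s t, t ≤ s → B s t = (1 : Matrix (Fin n) (Fin n) R) s t)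
    (X Y : Matrix (Fin n) (Fin n) R) (i j : Fin n) :
    stackedPair (X * B) (Y * B) i j =
      stackedPair X Y i j * B.submatrix (firstCol j) (firstCol j) := by
  ext r c
  rw [mul_apply]
  by_cases h : i.val + r.val < n
  · simp only [stackedPair, of_apply, dif_pos h, mul_apply_firstCol hB, submatrix_apply]
  · simp only [stackedPair, of_apply, dif_neg h, mul_apply_firstCol hB, submatrix_apply]

/-- The chosen rows are stable under `A`: a row below `j'` only receives rows below it, and by `hAi`
row `i` receives nothing from the other rows up to `j'`. So `A` acts on the minor through a
unitriangular principal submatrix. -/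
theorem det_minorMatrix_mul_left {A : Matrix (Fin n) (Fin n) R}
    (hA : ∀ s t, t ≤ s → A s t = (1 : Matrix (Fin n) (Fin n) R) s t)
    (X : Matrix (Fin n) (Fin n) R) {i j : Fin n} (hij : i ≤ j.rev)
    (hAi : ∀ t ≤ j.rev, A i t = (1 : Matrix (Fin n) (Fin n) R) i t) :
    (minorMatrix (A * X) i j).det = (minorMatrix X i j).det := by
  let row : Fin (j.val + 1) → Fin n := fun r => if r.val = 0 then i else lastRow j r
  have hlast : ∀ r : Fin (j.val + 1), r.val ≠ 0 → j.rev < lastRow j r := by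
    intro r hr
    simp only [Fin.lt_def, lastRow]
    omega
  have hinj : Function.Injective row := by
    intro r s h
    by_cases hr : r.val = 0 <;> by_cases hs : s.val = 0
    · exact Fin.ext (hr.trans hs.symm)
    · simp only [row, hr, hs, if_true, if_false] at h
      exact absurd (hij.trans_lt (hlast s hs)) (by rw [h]; exact lt_irrefl _)
    · simp only [row, hr, hs, if_true, if_false] at h
      exact absurd (hij.trans_lt (hlast r hr)) (by rw [h]; exact lt_irrefl _)
    · simp only [row, hr, hs, if_false] at h
      exact lastRow_injective j h
  have key : minorMatrix (A * X) i j = A.submatrix row row * minorMatrix X i j := by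
    ext r c
    rw [mul_apply]
    change (A * X) (row r) (firstCol j c) = ∑ s, A (row r) (row s) * X (row s) (firstCol j c)
    rw [mul_apply]
    symm
    apply Fintype.sum_of_injective row hinj
    · intro t ht
      have hti : t ≠ i := by
        rintro rfl
        exact ht ⟨0, by simp [row]⟩
      have htj : t ≤ j.rev := by
        by_contra hlt
        apply ht
        have hlt' : j.rev.val < t.val := not_le.mp hlt
        have h1 : j.rev.val = n - (j.val + 1) := Fin.val_rev j
        refine ⟨⟨t.val - j.rev.val, by omega⟩, ?_⟩
        have : ¬ (t.val - j.rev.val = 0) := by omega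
        simp only [row, this, if_false, lastRow]
        exact Fin.ext (by simp only; omega)
      by_cases hr : r.val = 0
      · have hrow : row r = i := if_pos hr
        rw [hrow, hAi t htj, one_apply_ne hti.symm, zero_mul]
      · have hrow : row r = lastRow j r := if_neg hr
        have := htj.trans_lt (hlast r hr)
        rw [hrow, hA _ _ this.le, one_apply_ne this.ne', zero_mul]
    · intro s; rfl
  rw [key, det_mul, det_eq_one_of_upperUnitriangular, one_mul]
  intro s t hst
  rw [submatrix_apply, hA]
  · simp [one_apply, hinj.eq_iff]
  · by_cases ht : t.val = 0
    · by_cases hs : s.val = 0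
      · rw [Fin.ext (ht.trans hs.symm)]
      · simp only [row, ht, hs, if_true, if_false]
        exact (hij.trans_lt (hlast s hs)).le
    · have hs : s.val ≠ 0 := by
        have : t.val ≤ s.val := hst
        omega
      simp only [row, ht, hs, if_false, lastRow, Fin.mk_le_mk]
      have : t.val ≤ s.val := hst
      omega

theorem det_stackedPair_mul_left {A : Matrix (Fin n) (Fin n) R}
    (hA : ∀ s t, t ≤ s → A s t = (1 : Matrix (Fin n) (Fin n) R) s t)
    (X Y : Matrix (Fin n) (Fin n) R) {i j : Fin n} (hij : j.rev ≤ i) :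
    (stackedPair (A * X) (A * Y) i j).det = (stackedPair X Y i j).det := by
  have hj : j.rev.val = n - (j.val + 1) := Fin.val_rev j
  have hij' : j.rev.val ≤ i.val := hij
  -- Both groups of rows are trailing rows of their matrices, so each is stable under `A`. `C` is
  -- block diagonal, with a trailing principal block of `A` for each group.
  let C : Matrix (Fin (j.val + 1)) (Fin (j.val + 1)) R := Matrix.of fun r s =>
    if h : i.val + r.val < n then
      (if h' : i.val + s.val < n then A ⟨_, h⟩ ⟨_, h'⟩ else 0)
    else if i.val + s.val < n then 0 else A (lastRow j r) (lastRow j s)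
  have key : stackedPair (A * X) (A * Y) i j = C * stackedPair X Y i j := by
    ext r c
    rw [mul_apply]
    by_cases h : i.val + r.val < n
    · simp only [stackedPair, C, of_apply, dif_pos h, mul_apply]
      symm
      rw [← Finset.sum_filter_of_ne (p := fun s : Fin (j.val + 1) => i.val + s.val < n)]
      · apply Finset.sum_of_injOn
          -- The value `i` is a default: the filter leaves only indices in the first branch.
          (fun s : Fin (j.val + 1) => if h' : i.val + s.val < n then ⟨_, h'⟩ else i)
        · intro s hs t ht hst
          simp only [Finset.coe_filter, Finset.mem_univ, true_and, Set.mem_ofPred_eq] at hs ht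
          simp only [dif_pos hs, dif_pos ht, Fin.mk.injEq, Nat.add_left_cancel_iff] at hst
          exact Fin.ext hst
        · intro s _
          simp
        · intro t _ ht
          have hlt : t.val < i.val + r.val := by
            by_contra hle
            apply ht
            refine ⟨⟨t.val - i.val, by omega⟩, ?_, ?_⟩
            · simp only [Finset.coe_filter, Finset.mem_univ, true_and, Set.mem_ofPred_eq]
              omega
            · have : i.val + (t.val - i.val) = t.val := by omega
              simp only [this, t.isLt, dif_pos]
          have hlt' : t < ⟨i.val + r.val, h⟩ := hlt
          rw [hA _ _ hlt'.le, one_apply_ne hlt'.ne', zero_mul]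
        · intro s hs
          simp only [Finset.mem_filter, Finset.mem_univ, true_and] at hs
          simp only [dif_pos hs]
      · intro s _ hs
        by_contra h'
        simp only [dif_neg h', zero_mul, ne_eq, not_true_eq_false] at hs
    · simp only [stackedPair, C, of_apply, dif_neg h, mul_apply]
      symm
      rw [← Finset.sum_filter_of_ne (p := fun s : Fin (j.val + 1) => ¬ i.val + s.val < n)]
      · apply Finset.sum_of_injOn (lastRow j) (lastRow_injective j).injOn
        · intro s _
          simp
        · intro t _ ht
          have hlt : t.val < j.rev.val + r.val := by
            by_contra hle
            apply ht
            refine ⟨⟨t.val - j.rev.val, by omega⟩, ?_, ?_⟩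
            · simp only [Finset.coe_filter, Finset.mem_univ, true_and, Set.mem_ofPred_eq]
              omega
            · exact Fin.ext (by simp only [lastRow]; omega)
          have hlt' : t < lastRow j r := hlt
          rw [hA _ _ hlt'.le, one_apply_ne hlt'.ne', zero_mul]
        · intro s hs
          simp only [Finset.mem_filter, Finset.mem_univ, true_and] at hs
          simp only [if_neg hs, dif_neg hs]
      · intro s _ hs h'
        simp only [if_pos h', zero_mul, ne_eq, not_true_eq_false] at hs
  rw [key, det_mul, det_eq_one_of_upperUnitriangular, one_mul]
  intro s t hst
  have hst' : t.val ≤ s.val := hst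
  simp only [C, of_apply]
  by_cases hs : i.val + s.val < n
  · have ht : i.val + t.val < n := by omega
    rw [dif_pos hs, dif_pos ht, hA _ _ (by simp only [Fin.mk_le_mk]; omega)]
    simp only [one_apply, Nat.add_left_cancel_iff, Fin.ext_iff]
  · rw [dif_neg hs]
    by_cases ht : i.val + t.val < n
    · rw [if_pos ht, one_apply_ne]
      rintro rfl
      exact hs ht
    · rw [if_neg ht, hA _ _ (by simp only [lastRow, Fin.mk_le_mk]; omega)]
      simp [one_apply, (lastRow_injective j).eq_iff]

theorem adjugate_conj {A B : Matrix (Fin n) (Fin n) R} (hAB : A * B = 1)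
    (hA : A.det = 1) (hB : B.det = 1) (X : Matrix (Fin n) (Fin n) R) :
    (A * X * B).adjugate = A * X.adjugate * B := by
  have hBA : B * A = 1 := mul_eq_one_comm.mp hAB
  have h1 : B.adjugate = A := by
    have := B.mul_adjugate
    rw [hB, one_smul] at this
    calc B.adjugate = A * B * B.adjugate := by rw [hAB, one_mul]
      _ = A := by rw [Matrix.mul_assoc, this, mul_one]
  have h2 : A.adjugate = B := by
    have := A.mul_adjugate
    rw [hA, one_smul] at this
    calc A.adjugate = B * A * A.adjugate := by rw [hBA, one_mul]
      _ = B := by rw [Matrix.mul_assoc, this, mul_one]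
  rw [adjugate_mul_distrib, adjugate_mul_distrib, h1, h2, Matrix.mul_assoc]

theorem det_stackedMatrix_conj {A B : Matrix (Fin n) (Fin n) R} (hAB : A * B = 1)
    (hA : ∀ s t, t ≤ s → A s t = (1 : Matrix (Fin n) (Fin n) R) s t)
    (hB : ∀ s t, t ≤ s → B s t = (1 : Matrix (Fin n) (Fin n) R) s t)
    (X : Matrix (Fin n) (Fin n) R) {i j : Fin n} (hij : j.rev ≤ i) :
    (stackedMatrix (A * X * B) i j).det = (stackedMatrix X i j).det := by
  rw [stackedMatrix_eq_stackedPair, adjugate_conj hAB (det_eq_one_of_upperUnitriangular hA)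
    (det_eq_one_of_upperUnitriangular hB), stackedPair_mul_right hB, det_mul,
    det_firstCol_submatrix hB, mul_one, det_stackedPair_mul_left hA _ _ hij]
  rfl

theorem det_minorMatrix_conj {A B : Matrix (Fin n) (Fin n) R}
    (hA : ∀ s t, t ≤ s → A s t = (1 : Matrix (Fin n) (Fin n) R) s t)
    (hB : ∀ s t, t ≤ s → B s t = (1 : Matrix (Fin n) (Fin n) R) s t)
    (X : Matrix (Fin n) (Fin n) R) {i j : Fin n} (hij : i ≤ j.rev)
    (hAi : ∀ t ≤ j.rev, A i t = (1 : Matrix (Fin n) (Fin n) R) i t) :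
    (minorMatrix (A * X * B) i j).det = (minorMatrix X i j).det := by
  rw [minorMatrix_mul_right hB, det_mul, det_firstCol_submatrix hB, mul_one,
    det_minorMatrix_mul_left hA X hij hAi]

/-- On the antidiagonal the last `j + 1` rows of `X` already fill the matrix, so no adjugate rows
occur. -/
theorem minorMatrix_rev_eq_stackedMatrix (X : Matrix (Fin n) (Fin n) R) (j : Fin n) :
    minorMatrix X j.rev j = stackedMatrix X j.rev j := by
  ext r c
  have h : j.rev.val + r.val < n := (lastRow j r).isLt
  simp only [minorMatrix, stackedMatrix, submatrix_apply, of_apply, dif_pos h]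
  congr 1
  split_ifs with hr
  · exact Fin.ext (by simp [hr])
  · rfl

end invariance

/-! ## Antitriangular matrices -/

section antitriangular

variable {n : ℕ} {R : Type*} [CommRing R]

/-- Reversing the rows of `A` and the columns of `B` keeps them inverse to each other and turns
antitriangular into triangular. -/
theorem antitriangular_inverse_lower {A B : Matrix (Fin n) (Fin n) R} (hAB : A * B = 1)
    (hA : ∀ i j : Fin n, j.rev < i → A i j = 0) (i j : Fin n) (hij : i < j.rev) : B i j = 0 := by
  have h1 : A.submatrix Fin.revPerm id * B.submatrix id Fin.revPerm = 1 := by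
    have h := submatrix_mul_equiv A B Fin.revPerm (Equiv.refl _) Fin.revPerm
    rwa [hAB, submatrix_one_equiv] at h
  have htri : (A.submatrix Fin.revPerm id).BlockTriangular (OrderDual.toDual : Fin n → _) := by
    intro s t hst
    apply hA
    have : s < t := hst
    simpa using this
  have : Invertible (A.submatrix Fin.revPerm id) := ⟨_, mul_eq_one_comm.mp h1, h1⟩
  have hinv := blockTriangular_inv_of_blockTriangular htri
  rw [Matrix.inv_eq_right_inv h1] at hinv
  have := @hinv i j.rev hij
  simpa using this

theorem antitriangular_inverse_upper {A B : Matrix (Fin n) (Fin n) R} (hAB : A * B = 1)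
    (hA : ∀ i j : Fin n, i < j.rev → A i j = 0) (i j : Fin n) (hij : j.rev < i) : B i j = 0 := by
  have h1 : A.submatrix Fin.revPerm id * B.submatrix id Fin.revPerm = 1 := by
    have h := submatrix_mul_equiv A B Fin.revPerm (Equiv.refl _) Fin.revPerm
    rwa [hAB, submatrix_one_equiv] at h
  have htri : (A.submatrix Fin.revPerm id).BlockTriangular (id : Fin n → Fin n) := by
    intro s t hst
    apply hA
    have : t < s := hst
    simpa using this
  have : Invertible (A.submatrix Fin.revPerm id) := ⟨_, mul_eq_one_comm.mp h1, h1⟩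
  have hinv := blockTriangular_inv_of_blockTriangular htri
  rw [Matrix.inv_eq_right_inv h1] at hinv
  have := @hinv i j.rev hij
  simpa using this

theorem adjugate_antidiagonal {Z : Matrix (Fin n) (Fin n) R} (hdet : Z.det = 1)
    (hZ : ∀ i j : Fin n, i < j.rev → Z i j = 0) (j : Fin n) :
    Z.adjugate j j.rev * Z j.rev j = 1 := by
  have hmul : Z * Z.adjugate = 1 := by rw [mul_adjugate, hdet, one_smul]
  have hmul' : Z.adjugate * Z = 1 := by rw [adjugate_mul, hdet, one_smul]
  have h := congrFun (congrFun hmul' j) j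
  rw [mul_apply, one_apply_eq, Finset.sum_eq_single j.rev] at h
  · exact h
  · intro k _ hk
    rcases lt_or_gt_of_ne hk with h1 | h1
    · rw [hZ _ _ h1, mul_zero]
    · rw [antitriangular_inverse_upper hmul hZ _ _ (Fin.rev_lt_iff.mp h1), zero_mul]
  · simp

/-- The extension of a matrix by zero to all natural indices. -/
def natEntry (Z : Matrix (Fin n) (Fin n) R) (a b : ℕ) : R :=
  if h : a < n ∧ b < n then Z ⟨a, h.1⟩ ⟨b, h.2⟩ else 0

theorem natEntry_val (Z : Matrix (Fin n) (Fin n) R) (i j : Fin n) : natEntry Z i j = Z i j := by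
  simp [natEntry]

/-- The minor on the rows `i, i + 1, …, i + k - 1` and the columns `j, j - 1, …, j - k + 1`. -/
def consecMinor (z : ℕ → ℕ → R) (k i j : ℕ) : R :=
  (Matrix.of fun r c : Fin k => z (i + r.val) (j - c.val)).det

theorem consecMinor_zero (z : ℕ → ℕ → R) (i j : ℕ) : consecMinor z 0 i j = 1 := by
  simp [consecMinor]

theorem consecMinor_succ (z : ℕ → ℕ → R) (k i j : ℕ) :
    consecMinor z (k + 1) i j = z i j * consecMinor z k (i + 1) (j - 1) +
      ∑ c : Fin k, (-1) ^ (c.val + 1) * z i (j - (c.val + 1)) *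
        (Matrix.of fun r s : Fin k => z (i + (r.val + 1)) (j - (c.succ.succAbove s).val)).det := by
  rw [consecMinor, det_succ_row_zero, Fin.sum_univ_succ]
  congr 1
  · simp only [Fin.val_zero, pow_zero, one_mul, of_apply, add_zero, Nat.sub_zero, consecMinor]
    congr 2
    ext r s
    simp only [submatrix_apply, of_apply, Fin.val_succ, Fin.succAbove_zero]
    congr 1 <;> omega

/-- The sign comes from reversing the columns. After that the adjugate rows vanish left of the
diagonal, because the inverse of `Z` is antitriangular of the opposite kind. The matrix is thus
block triangular, and its lower block is itself triangular. -/
theorem sign_mul_det_stackedMatrix {Z : Matrix (Fin n) (Fin n) R} (hdet : Z.det = 1)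
    (hZ : ∀ i j : Fin n, i < j.rev → Z i j = 0) {i j : Fin n} (hij : j.rev ≤ i) :
    ((Equiv.Perm.sign (Fin.revPerm : Equiv.Perm (Fin (j.val + 1))) : ℤ) : R) *
        (stackedMatrix Z i j).det =
      consecMinor (natEntry Z) (n - i) i j *
        ∏ r : {r : Fin (j.val + 1) // ¬ i.val + r.val < n},
          Z.adjugate (lastRow j r) (lastRow j r).rev := by
  have hj : j.rev.val = n - (j.val + 1) := Fin.val_rev j
  have hij' : j.rev.val ≤ i.val := hij
  have hmul : Z * Z.adjugate = 1 := by rw [mul_adjugate, hdet, one_smul]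
  have hadj := antitriangular_inverse_upper hmul hZ
  have hrev : ∀ r : Fin (j.val + 1), firstCol j r.rev = (lastRow j r).rev := by
    intro r
    apply Fin.ext
    have := r.isLt
    simp only [firstCol, Fin.val_castLE, Fin.val_rev, lastRow]
    omega
  rw [← det_permute', twoBlockTriangular_det _ (fun r => i.val + r.val < n)]
  · congr 1
    · let e : Fin (n - i) ≃ {r : Fin (j.val + 1) // i.val + r.val < n} :=
        { toFun := fun r => ⟨⟨r.val, by omega⟩, by simp only; omega⟩
          invFun := fun r => ⟨r.val.val, by have := r.2; omega⟩
          left_inv := fun r => rfl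
          right_inv := fun r => rfl }
      rw [← det_submatrix_equiv_self e, consecMinor]
      congr 1
      ext r c
      have h1 : i.val + r.val < n := by omega
      have h2 : j.val - c.val < n := by omega
      simp only [natEntry, of_apply, h1, h2, and_self, dif_pos, submatrix_apply,
        toSquareBlockProp_def, e, stackedMatrix, Equiv.coe_fn_mk, id, Fin.revPerm_apply]
      congr 1
      apply Fin.ext
      simp only [firstCol, Fin.val_castLE, Fin.val_rev]
      omega
    · rw [det_of_isUpperTriangular]
      · apply Finset.prod_congr rfl
        intro r _
        simp only [toSquareBlockProp_def, of_apply, submatrix_apply, stackedMatrix, dif_neg r.2,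
          Fin.revPerm_apply, id, hrev]
      · intro r c hrc
        have hlt : c.val.val < r.val.val := hrc
        simp only [toSquareBlockProp_def, of_apply, submatrix_apply, stackedMatrix, dif_neg r.2,
          Fin.revPerm_apply, id, hrev]
        apply hadj
        rw [Fin.rev_rev, Fin.lt_def]
        simp only [lastRow]
        omega
  · intro r hr c hc
    simp only [of_apply, submatrix_apply, stackedMatrix, dif_neg hr, Fin.revPerm_apply, id, hrev]
    apply hadj
    rw [Fin.rev_rev, Fin.lt_def]
    simp only [lastRow]
    omega

end antitriangular

/-! ### Recovering an antitriangular matrix from its determinants -/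

section subfield

variable {n : ℕ} {F : Type*} [Field F]

theorem det_mem_subfield {m : Type*} [Fintype m] [DecidableEq m] (S : Subfield F)
    {M : Matrix m m F} (h : ∀ i j, M i j ∈ S) : M.det ∈ S := by
  rw [det_apply']
  refine sum_mem fun σ _ => mul_mem (intCast_mem _ _) (prod_mem fun i _ => h _ _)

/-- Rows are treated from the bottom upwards (`k` counts the rows below row `i`), each from left to
right. In the expansion of the minor along its top row, `z i j` is the only unknown entry, and its
cofactor is a smaller nonzero minor of the same kind. -/
theorem mem_subfield_of_consecMinor_mem (S : Subfield F) {z : ℕ → ℕ → F}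
    (hz : ∀ i j, i + j + 1 < n → z i j ∈ S)
    (hM : ∀ i j, i < n → j < n → n ≤ i + j + 1 → consecMinor z (n - i) i j ∈ S)
    (hM' : ∀ i j, i < n → j < n → n ≤ i + j + 1 → consecMinor z (n - i) i j ≠ 0) (k : ℕ) :
    ∀ i, i + k + 1 = n → ∀ j < n, z i j ∈ S := by
  induction k using Nat.strong_induction_on with
  | _ k ihk =>
    intro i hi j
    induction j using Nat.strong_induction_on with
    | _ j ihj =>
      intro hj
      by_cases hij : i + j + 1 < n
      · exact hz i j hij
      have hsucc := consecMinor_succ z k i j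
      have hmem := hM i j (by omega) hj (by omega)
      rw [show n - i = k + 1 by omega, hsucc] at hmem
      have hnext : consecMinor z k (i + 1) (j - 1) ∈ S ∧
          consecMinor z k (i + 1) (j - 1) ≠ 0 := by
        -- In the bottom row `j - 1` may be truncated; this is harmless, since the remaining minor
        -- is empty.
        rcases Nat.eq_zero_or_pos k with rfl | hk
        · rw [consecMinor_zero]; exact ⟨one_mem _, one_ne_zero⟩
        · have h1 := hM (i + 1) (j - 1) (by omega) (by omega) (by omega)
          have h2 := hM' (i + 1) (j - 1) (by omega) (by omega) (by omega)
          rw [show n - (i + 1) = k by omega] at h1 h2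
          exact ⟨h1, h2⟩
      have hrest : (∑ c : Fin k, (-1) ^ (c.val + 1) * z i (j - (c.val + 1)) *
          (Matrix.of fun r s : Fin k =>
            z (i + (r.val + 1)) (j - (c.succ.succAbove s).val)).det) ∈ S := by
        refine sum_mem fun c _ => mul_mem (mul_mem (pow_mem (neg_mem (one_mem _)) _) ?_) ?_
        · exact ihj _ (by omega) (by omega)
        · refine det_mem_subfield S fun r s => ?_
          exact ihk (k - (r.val + 1)) (by omega) _ (by omega) _ (by omega)
      have hprod := (add_mem_cancel_right hrest).mp hmem
      have := div_mem hprod hnext.1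
      rwa [mul_div_cancel_right₀ _ hnext.2] at this

/-- Only the first term of the expansion survives, so an antidiagonal entry is a quotient of
successive minors. -/
theorem antidiagonal_mem_subfield (S : Subfield F) {z : ℕ → ℕ → F}
    (hz : ∀ i j, i + j + 1 < n → z i j = 0)
    (hM : ∀ i j, i + j + 1 = n → consecMinor z (n - i) i j ∈ S)
    (hM' : ∀ i j, i + j + 1 = n → consecMinor z (n - i) i j ≠ 0)
    {i j : ℕ} (hij : i + j + 1 = n) : z i j ∈ S := by
  have hsucc := consecMinor_succ z j i j
  rw [Finset.sum_eq_zero, add_zero] at hsucc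
  · have hmem := hM i j hij
    rw [show n - i = j + 1 by omega, hsucc] at hmem
    rcases Nat.eq_zero_or_pos j with rfl | hj
    · rwa [consecMinor_zero, mul_one] at hmem
    · have h1 := hM (i + 1) (j - 1) (by omega)
      have h2 := hM' (i + 1) (j - 1) (by omega)
      rw [show n - (i + 1) = j by omega] at h1 h2
      have := div_mem hmem h1
      rwa [mul_div_cancel_right₀ _ h2] at this
  · intro c _
    rw [hz _ _ (by omega), mul_zero, zero_mul]

/-- The entries of an antitriangular matrix are rational functions of the determinants of its
stacked matrices. -/
theorem mem_subfield_of_det_stackedMatrix_mem (S : Subfield F) {Z : Matrix (Fin n) (Fin n) F}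
    (hdet : Z.det = 1) (hZ : ∀ i j : Fin n, i < j.rev → Z i j = 0)
    (hS : ∀ i j : Fin n, j.rev ≤ i → (stackedMatrix Z i j).det ∈ S)
    (hS' : ∀ i j : Fin n, j.rev ≤ i → (stackedMatrix Z i j).det ≠ 0) (i j : Fin n) :
    Z i j ∈ S := by
  have hz : ∀ i j, i + j + 1 < n → natEntry Z i j = 0 := by
    intro i j hij
    rw [natEntry, dif_pos ⟨by omega, by omega⟩]
    apply hZ
    simp only [Fin.lt_def, Fin.val_rev]
    omega
  have hle : ∀ i j (hi : i < n) (hj : j < n), n ≤ i + j + 1 →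
      (⟨j, hj⟩ : Fin n).rev ≤ ⟨i, hi⟩ := by
    intro i j hi hj hij
    simp only [Fin.le_def, Fin.val_rev]
    omega
  have hM' : ∀ i j, i < n → j < n → n ≤ i + j + 1 → consecMinor (natEntry Z) (n - i) i j ≠ 0 := by
    intro i j hi hj hij h0
    have h := sign_mul_det_stackedMatrix hdet hZ (hle i j hi hj hij)
    simp only [h0, zero_mul] at h
    rcases mul_eq_zero.mp h with h | h
    · rcases Int.units_eq_one_or (Equiv.Perm.sign (Fin.revPerm : Equiv.Perm (Fin (j + 1))))
        with h1 | h1 <;> simp [h1] at h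
    · exact hS' _ _ (hle i j hi hj hij) h
  -- The antidiagonal must come first: there the adjugate factor is an empty product, and its
  -- entries then determine the adjugate factors at all other positions.
  have hanti : ∀ j : Fin n, Z j.rev j ∈ S := by
    intro j
    rw [← natEntry_val Z]
    refine antidiagonal_mem_subfield (n := n) S hz ?_ ?_ (by rw [Fin.val_rev]; omega)
    · intro i j hij
      have hi : i < n := by omega
      have hj : j < n := by omega
      have h := sign_mul_det_stackedMatrix hdet hZ (hle i j hi hj hij.ge)
      rw [Finset.prod_eq_one, mul_one] at h
      · simp only at h
        rw [← h]
        exact mul_mem (intCast_mem _ _) (hS _ _ (hle i j hi hj hij.ge))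
      · rintro ⟨r, hr⟩
        exact absurd (show i + r.val < n by have : r.val < j + 1 := r.isLt; omega) hr
    · intro i j hij
      exact hM' i j (by omega) (by omega) hij.ge
  have hadj : ∀ j : Fin n, Z.adjugate j j.rev ∈ S ∧ Z.adjugate j j.rev ≠ 0 := by
    intro j
    have h := adjugate_antidiagonal hdet hZ j
    have := eq_inv_of_mul_eq_one_left h
    exact ⟨this ▸ inv_mem (hanti j), left_ne_zero_of_mul_eq_one h⟩
  rw [← natEntry_val Z]
  refine mem_subfield_of_consecMinor_mem (n := n) S (fun i j h => hz i j h ▸ zero_mem _) ?_ hM'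
    (n - 1 - i) i (by omega) j j.isLt
  intro i j hi hj hij
  have h := sign_mul_det_stackedMatrix hdet hZ (hle i j hi hj hij)
  have hP := Finset.prod_ne_zero_iff.mpr fun
    (r : {r : Fin (j + 1) // ¬ i + r.val < n}) (_ : r ∈ Finset.univ) =>
      (hadj (lastRow ⟨j, hj⟩ r.val)).2
  have h2 : consecMinor (natEntry Z) (n - i) i j = _ := eq_div_of_mul_eq hP h.symm
  rw [h2]
  exact div_mem (mul_mem (intCast_mem _ _) (hS _ _ (hle i j hi hj hij)))
    (prod_mem fun r _ => (hadj _).1)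

end subfield

/-! ## The canonical form of a generic matrix under unitriangular conjugation -/

section blockUnitriangular

variable {m α R : Type*} [DecidableEq m] [LinearOrder α] [CommRing R]

theorem blockTriangular_of_blockUnitriangular {b : m → α} {A : Matrix m m R}
    (hA : ∀ s t, b t ≤ b s → A s t = (1 : Matrix m m R) s t) : A.BlockTriangular b := by
  intro s t hst
  rw [hA s t hst.le, one_apply_ne]
  rintro rfl
  exact lt_irrefl _ hst

theorem blockTriangular_of_mul_eq_one [Fintype m] {b : m → α} {A B : Matrix m m R} (hAB : A * B = 1)
    (hA : A.BlockTriangular b) : B.BlockTriangular b := by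
  have : Invertible A := ⟨B, mul_eq_one_comm.mp hAB, hAB⟩
  have hinv := blockTriangular_inv_of_blockTriangular hA
  rwa [Matrix.inv_eq_right_inv hAB] at hinv

theorem blockUnitriangular_of_mul_eq_one [Fintype m] {b : m → α} {A B : Matrix m m R} (hAB : A * B = 1)
    (hA : ∀ s t, b t ≤ b s → A s t = (1 : Matrix m m R) s t) (s t : m) (hst : b t ≤ b s) :
    B s t = (1 : Matrix m m R) s t := by
  have hB := blockTriangular_of_mul_eq_one hAB (blockTriangular_of_blockUnitriangular hA)
  rw [← hAB, mul_apply, Finset.sum_eq_single s]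
  · rw [hA s s le_rfl, one_apply_eq, one_mul]
  · intro k _ hk
    rcases le_or_gt (b k) (b s) with h | h
    · rw [hA s k h, one_apply_ne hk.symm, zero_mul]
    · rw [hB (hst.trans_lt h), mul_zero]
  · simp

end blockUnitriangular

/-! ### Reduction to antitriangular form by the frame of two flags -/

section frame

variable {n : ℕ} {F : Type*} [Field F]

/-- The column `t` spans the intersection of the coordinate flag with its image under `X`. -/
def frame (X : Matrix (Fin n) (Fin n) F) : Matrix (Fin n) (Fin n) F :=
  Matrix.of fun i t => (minorMatrix X i t.rev).det / (minorMatrix X t t.rev).det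

theorem frame_upperUnitriangular {X : Matrix (Fin n) (Fin n) F}
    (hX : ∀ t : Fin n, (minorMatrix X t t.rev).det ≠ 0) (s t : Fin n) (hst : t ≤ s) :
    frame X s t = (1 : Matrix (Fin n) (Fin n) F) s t := by
  rcases hst.eq_or_lt with rfl | hlt
  · rw [frame, of_apply, div_self (hX t), one_apply_eq]
  · rw [frame, of_apply, one_apply_ne hlt.ne', div_eq_zero_iff]
    left
    have hlt' : t.val < s.val := hlt
    have ht : t.rev.val = n - (t.val + 1) := Fin.val_rev t
    have h1 : s.val - t.val < t.rev.val + 1 := by omega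
    -- Row `s` lies below `t`, so it occurs twice: on top and as the trailing row number `s - t`.
    apply det_zero_of_row_eq (i := 0) (j := ⟨s.val - t.val, h1⟩)
    · intro h
      have := congrArg Fin.val h
      simp only [Fin.val_zero] at this
      omega
    · ext c
      have h2 : ¬ (s.val - t.val = 0) := by omega
      simp only [minorMatrix, submatrix_apply, Fin.val_zero, if_true, h2, if_false]
      congr 1
      apply Fin.ext
      simp only [lastRow, Fin.rev_rev]
      omega

/-- Laplace expansion of the minors along the top row `i`: the cofactors do not depend on `i`, so
they are the entries of `V`. -/
theorem exists_mul_eq_frame (X : Matrix (Fin n) (Fin n) F) :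
    ∃ V : Matrix (Fin n) (Fin n) F, X * V = frame X ∧ ∀ i j : Fin n, j.rev < i → V i j = 0 := by
  refine ⟨Matrix.of fun c t => if h : c.val < t.rev.val + 1 then
    (-1) ^ c.val * ((minorMatrix X t t.rev).submatrix Fin.succ
      (Fin.succAbove ⟨c.val, h⟩)).det / (minorMatrix X t t.rev).det else 0, ?_, ?_⟩
  · ext i t
    rw [mul_apply, frame, of_apply, det_succ_row_zero, Finset.sum_div]
    symm
    apply Fintype.sum_of_injective (firstCol t.rev) (firstCol_injective _)
    · intro c hc
      rw [of_apply, dif_neg, mul_zero]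
      intro h
      exact hc ⟨⟨c.val, h⟩, rfl⟩
    · intro c
      have h : (firstCol t.rev c).val < t.rev.val + 1 := c.isLt
      rw [of_apply, dif_pos h]
      have h1 : minorMatrix X i t.rev 0 c = X i (firstCol t.rev c) := by simp [minorMatrix]
      have h2 : (minorMatrix X i t.rev).submatrix Fin.succ c.succAbove =
          (minorMatrix X t t.rev).submatrix Fin.succ c.succAbove := by
        ext r s
        simp [minorMatrix]
      rw [h1, h2, mul_comm _ (X i _), mul_assoc, mul_div_assoc]
      rfl
  · intro i j hij
    rw [of_apply, dif_neg]
    have : j.rev.val < i.val := hij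
    omega

/-- From `X * V = frame X` it follows that `U * X` is the inverse of `V`, hence zero for `i < j'`.
Multiplying on the right by an upper triangular matrix preserves this. -/
theorem frame_conj_antitriangular {X U : Matrix (Fin n) (Fin n) F}
    (hX : ∀ t : Fin n, (minorMatrix X t t.rev).det ≠ 0) (hU : U * frame X = 1)
    (i j : Fin n) (hij : i < j.rev) : (U * X * frame X) i j = 0 := by
  obtain ⟨V, hV, hV0⟩ := exists_mul_eq_frame X
  have h1 : V * (U * X) = 1 := by
    rw [mul_eq_one_comm, Matrix.mul_assoc, hV, hU]
  have h2 := antitriangular_inverse_lower h1 hV0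
  rw [mul_apply]
  apply Finset.sum_eq_zero
  intro k _
  rcases le_or_gt k j with hk | hk
  · rw [h2 i k (hij.trans_le (Fin.rev_le_rev.mpr hk)), zero_mul]
  · rw [frame_upperUnitriangular hX _ _ hk.le, one_apply_ne hk.ne', mul_zero]

theorem mul_mem_subfield {m : Type*} [Fintype m] (S : Subfield F) {A B : Matrix m m F}
    (hA : ∀ i j, A i j ∈ S) (hB : ∀ i j, B i j ∈ S) (i j : m) : (A * B) i j ∈ S := by
  rw [mul_apply]
  exact sum_mem fun k _ => mul_mem (hA i k) (hB k j)

theorem adjugate_mem_subfield {m : Type*} [Fintype m] [DecidableEq m] (S : Subfield F)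
    {A : Matrix m m F} (hA : ∀ i j, A i j ∈ S) (i j : m) : A.adjugate i j ∈ S := by
  rw [adjugate_apply]
  apply det_mem_subfield
  intro s t
  rw [updateRow_apply]
  split_ifs
  · rw [Pi.single_apply]
    split_ifs
    · exact one_mem _
    · exact zero_mem _
  · exact hA s t

/-- A matrix of determinant one with non-vanishing invariants is conjugate under the unipotent
radical to a matrix whose entries are rational functions of the invariants. -/
theorem exists_blockUnitriangular_conj_mem {α : Type*} [LinearOrder α] {b : Fin n → α}
    (hb : Monotone b) (S : Subfield F) {X : Matrix (Fin n) (Fin n) F} (hdet : X.det = 1)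
    (hminor : ∀ i j : Fin n, i ≤ j.rev → b j.rev ≤ b i → (minorMatrix X i j).det ∈ S)
    (hstack : ∀ i j : Fin n, j.rev ≤ i → (stackedMatrix X i j).det ∈ S)
    (hne : ∀ i j : Fin n, j.rev ≤ i → (stackedMatrix X i j).det ≠ 0) :
    ∃ W W' : Matrix (Fin n) (Fin n) F, W' * W = 1 ∧
      (∀ s t, b t ≤ b s → W s t = (1 : Matrix (Fin n) (Fin n) F) s t) ∧
      ∀ i j, (W' * X * W) i j ∈ S := by
  have hX : ∀ t : Fin n, (minorMatrix X t t.rev).det ≠ 0 := by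
    intro t
    have := hne t t.rev (Fin.rev_rev t).le
    have h := minorMatrix_rev_eq_stackedMatrix X t.rev
    rw [Fin.rev_rev] at h
    rwa [h]
  have hu := frame_upperUnitriangular hX
  set u := frame X with hu_def
  have hudet : u.det = 1 := det_eq_one_of_upperUnitriangular hu
  have huu : u * u.adjugate = 1 := by rw [mul_adjugate, hudet, one_smul]
  have huu' : u.adjugate * u = 1 := mul_eq_one_comm.mp huu
  have hu' := blockUnitriangular_of_mul_eq_one (b := id) huu hu
  have hZdet : (u.adjugate * X * u).det = 1 := by
    rw [det_mul, det_mul, hdet, hudet, det_eq_one_of_upperUnitriangular hu']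
    simp
  have hZS : ∀ i j, (u.adjugate * X * u) i j ∈ S := by
    apply mem_subfield_of_det_stackedMatrix_mem S hZdet (frame_conj_antitriangular hX huu')
    · intro i j hij
      rw [det_stackedMatrix_conj huu' hu' hu X hij]
      exact hstack i j hij
    · intro i j hij
      rw [det_stackedMatrix_conj huu' hu' hu X hij]
      exact hne i j hij
  -- The minors giving `u s t` need not lie in `S` when `s` and `t` are in different blocks. The
  -- block diagonal part `l` uses only those in `S`, and `u * l⁻¹` is block unitriangular.
  let l : Matrix (Fin n) (Fin n) F := Matrix.of fun s t => if b s = b t then u s t else 0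
  have hl : ∀ s t, t ≤ s → l s t = (1 : Matrix (Fin n) (Fin n) F) s t := by
    intro s t hst
    simp only [l, of_apply]
    split_ifs with h
    · exact hu s t hst
    · rw [one_apply_ne]
      rintro rfl
      exact h rfl
  have hlS : ∀ s t, l s t ∈ S := by
    intro s t
    simp only [l, of_apply]
    split_ifs with h
    · rcases le_or_gt s t with hst | hst
      · exact div_mem
          (hminor s t.rev (by rwa [Fin.rev_rev]) (by rw [Fin.rev_rev, h]))
          (hminor t t.rev (by rw [Fin.rev_rev]) (by rw [Fin.rev_rev]))
      · rw [hu s t hst.le, one_apply_ne hst.ne']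
        exact zero_mem _
    · exact zero_mem _
  have hldet : l.det = 1 := det_eq_one_of_upperUnitriangular hl
  have hll : l * l.adjugate = 1 := by rw [mul_adjugate, hldet, one_smul]
  have hll' : l.adjugate * l = 1 := mul_eq_one_comm.mp hll
  have hltri : l.BlockTriangular b := by
    intro s t hst
    simp only [l, of_apply]
    rw [if_neg hst.ne']
  have hl'tri := blockTriangular_of_mul_eq_one hll hltri
  refine ⟨u * l.adjugate, l * u.adjugate, ?_, ?_, ?_⟩
  · rw [Matrix.mul_assoc, ← Matrix.mul_assoc u.adjugate, huu', one_mul, hll]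
  · have hN : ∀ s t, b t ≤ b s → (u - l) s t = 0 := by
      intro s t hst
      rw [Matrix.sub_apply, sub_eq_zero]
      simp only [l, of_apply]
      split_ifs with h
      · rfl
      · have hlt : t < s := hb.reflect_lt (lt_of_le_of_ne hst fun h' => h h'.symm)
        rw [hu s t hlt.le, one_apply_ne hlt.ne']
    intro s t hst
    have h1 : u * l.adjugate = 1 + (u - l) * l.adjugate := by
      rw [Matrix.sub_mul, hll]
      abel
    rw [h1, Matrix.add_apply, mul_apply, Finset.sum_eq_zero, add_zero]
    intro k _
    rcases le_or_gt (b k) (b s) with h | h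
    · rw [hN s k h, zero_mul]
    · rw [hl'tri (hst.trans_lt h), mul_zero]
  · have h1 : l * u.adjugate * X * (u * l.adjugate) =
        l * (u.adjugate * X * u) * l.adjugate := by
      simp only [Matrix.mul_assoc]
    rw [h1]
    exact mul_mem_subfield S (mul_mem_subfield S hlS hZS) (adjugate_mem_subfield S hlS)

end frame

/-! ## The values of the polynomials `J_ij` -/

section value

variable {n : ℕ} {R : Type*} [CommRing R]

/-- The value of the polynomial `J_ij` at the matrix `X`. -/
def JValue (X : Matrix (Fin n) (Fin n) R) (i j : Fin n) : R :=
  if i ≤ j.rev then (minorMatrix X i j).det else (stackedMatrix X i j).det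

theorem JValue_of_le (X : Matrix (Fin n) (Fin n) R) {i j : Fin n} (h : i ≤ j.rev) :
    JValue X i j = (minorMatrix X i j).det := if_pos h

theorem JValue_of_ge (X : Matrix (Fin n) (Fin n) R) {i j : Fin n} (h : j.rev ≤ i) :
    JValue X i j = (stackedMatrix X i j).det := by
  rcases h.eq_or_lt with rfl | h
  · rw [JValue, if_pos le_rfl, minorMatrix_rev_eq_stackedMatrix]
  · rw [JValue, if_neg (not_le.mpr h)]

theorem map_JValue {S : Type*} [CommRing S] (f : R →+* S) (X : Matrix (Fin n) (Fin n) R)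
    (i j : Fin n) : f (JValue X i j) = JValue (X.map f) i j := by
  rw [JValue, JValue]
  split_ifs
  · rw [RingHom.map_det]
    rfl
  · rw [RingHom.map_det]
    congr 1
    ext r c
    have hadj : (X.map f).adjugate = X.adjugate.map f := (f.map_adjugate X).symm
    simp only [RingHom.mapMatrix_apply, Matrix.map_apply, stackedMatrix, of_apply, hadj]
    split_ifs <;> rfl

/-- The condition on the position enters for `i ≤ j'`: if `t ≤ j'` then `b t ≤ b j' ≤ b i`, so row
`i` of `A` agrees with the identity in column `t`. -/
theorem JValue_conj {α : Type*} [LinearOrder α] {b : Fin n → α} (hb : Monotone b)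
    {A B : Matrix (Fin n) (Fin n) R} (hAB : A * B = 1)
    (hB : ∀ s t, b t ≤ b s → B s t = (1 : Matrix (Fin n) (Fin n) R) s t)
    (X : Matrix (Fin n) (Fin n) R) {i j : Fin n} (hij : b j.rev ≤ b i) :
    JValue (A * X * B) i j = JValue X i j := by
  have hA := blockUnitriangular_of_mul_eq_one (mul_eq_one_comm.mp hAB) hB
  rcases le_total i j.rev with h | h
  · rw [JValue_of_le _ h, JValue_of_le _ h]
    exact det_minorMatrix_conj (fun s t hst => hA s t (hb hst)) (fun s t hst => hB s t (hb hst)) X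
      h fun t ht => hA i t ((hb ht).trans hij)
  · rw [JValue_of_ge _ h, JValue_of_ge _ h]
    exact det_stackedMatrix_conj hAB (fun s t hst => hA s t (hb hst))
      (fun s t hst => hB s t (hb hst)) X h

theorem JValue_zero_rev_zero [NeZero n] (X : Matrix (Fin n) (Fin n) R) :
    JValue X 0 (Fin.rev 0) = X.det := by
  rw [JValue_of_le _ (Fin.zero_le _)]
  have hn : (Fin.rev (0 : Fin n)).val + 1 = n := by
    rw [Fin.val_rev]
    simp
    have := NeZero.pos n
    omega
  rw [← det_submatrix_equiv_self (finCongr hn) X]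
  congr 1
  ext r c
  simp only [minorMatrix, submatrix_apply]
  congr 1
  apply Fin.ext
  split_ifs with h
  · simp only [Fin.val_zero]
    exact h.symm
  · simp only [lastRow, Fin.rev_rev, Fin.val_zero, zero_add]
    rfl

end value

theorem exists_det_stackedMatrix_ne_zero {K : Type*} [Field K] {n : ℕ} {i j : Fin n}
    (hij : j.rev ≤ i) :
    ∃ Z : Matrix (Fin n) (Fin n) K, Z.det = 1 ∧ (stackedMatrix Z i j).det ≠ 0 := by
  have hij' : n - (j.val + 1) ≤ i.val := by rw [← Fin.val_rev]; exact hij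
  have hn : 0 < n := i.pos
  -- Ones on the antidiagonal make `Y` invertible; ones on the parallel through `(i, j)` make the
  -- consecutive minor triangular with nonzero diagonal. The first row is rescaled below to get
  -- determinant one.
  let Y : Matrix (Fin n) (Fin n) K := Matrix.of fun a b =>
    if a.val + b.val + 1 = n ∨ a.val + b.val = i.val + j.val then 1 else 0
  have hY : Y.det ≠ 0 := by
    intro h0
    have h1 : (Y.submatrix id Fin.revPerm).det = 1 := by
      rw [det_of_isLowerTriangular]
      · apply Finset.prod_eq_one
        intro a _
        simp only [Y, submatrix_apply, of_apply, Fin.revPerm_apply, id, Fin.val_rev]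
        rw [if_pos (Or.inl (by omega))]
      · intro a b hab
        have hab' : a.val < b.val := hab
        simp only [Y, submatrix_apply, of_apply, Fin.revPerm_apply, id, Fin.val_rev]
        rw [if_neg (by omega)]
    rw [det_permute', h0, mul_zero] at h1
    exact zero_ne_one h1
  let v : Fin n → K := fun a => if a = ⟨0, hn⟩ then Y.det⁻¹ else 1
  have hv : ∀ a, v a ≠ 0 := by
    intro a
    simp only [v]
    split_ifs
    · exact inv_ne_zero hY
    · exact one_ne_zero
  let Z : Matrix (Fin n) (Fin n) K := Matrix.of fun a b => v a * Y a b
  have hdet : Z.det = 1 := by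
    have h1 : Z.det = (∏ a, v a) * Y.det := det_mul_column v Y
    rw [h1, Finset.prod_ite_eq' Finset.univ (⟨0, hn⟩ : Fin n), if_pos (Finset.mem_univ _),
      inv_mul_cancel₀ hY]
  have hZ : ∀ a b : Fin n, a < b.rev → Z a b = 0 := by
    intro a b hab
    have hab' : a.val < n - (b.val + 1) := by rw [← Fin.val_rev]; exact hab
    simp only [Z, Y, of_apply]
    rw [if_neg (by omega), mul_zero]
  refine ⟨Z, hdet, fun h0 => ?_⟩
  have h := sign_mul_det_stackedMatrix hdet hZ hij
  rw [h0, mul_zero] at h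
  refine mul_ne_zero ?_ (Finset.prod_ne_zero_iff.mpr fun r _ => ?_) h.symm
  · rw [consecMinor, det_of_isUpperTriangular]
    · apply Finset.prod_ne_zero_iff.mpr
      intro r _
      have h1 : i.val + r.val < n := by omega
      have h2 : j.val - r.val < n := by omega
      simp only [natEntry, of_apply, h1, h2, and_self, dif_pos, Z, Y]
      rw [if_pos (Or.inr (by omega)), mul_one]
      exact hv _
    · intro r c hrc
      have hrc' : c.val < r.val := hrc
      have h1 : i.val + r.val < n := by omega
      have h2 : j.val - c.val < n := by omega
      simp only [natEntry, of_apply, h1, h2, and_self, dif_pos, Z, Y]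
      rw [if_neg (by omega), mul_zero]
  · exact left_ne_zero_of_mul_eq_one (adjugate_antidiagonal hdet hZ _)

theorem index_monotone {n : ℕ} (c : Composition n) : Monotone c.index := by
  intro i j hij
  by_contra h
  have h1 : (c.index j).val + 1 ≤ (c.index i).val := not_le.mp h
  have h2 := c.lt_sizeUpTo_index_succ j
  have h3 := c.sizeUpTo_index_le i
  have h4 := c.monotone_sizeUpTo h1
  have h5 : i.val ≤ j.val := hij
  simp only [Fin.val_succ] at h2
  omega

/-! ## Rational invariants -/

section rational

variable {n : ℕ} {K : Type*} [Field K]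

theorem mk_J {R : Type*} [CommRing R] (f : CoordRing n K →+* R) (i j : Fin n) :
    f (Ideal.Quotient.mk _ (J K i j)) = JValue ((genericMatrix n K).map f) i j := by
  rw [← map_JValue, genericMatrix, ← map_JValue]
  rfl

/-- The generic matrix over the field of rational functions. -/
noncomputable def ratMatrix (n : ℕ) (K : Type*) [Field K] :
    Matrix (Fin n) (Fin n) (SLFunctionField n K) :=
  (genericMatrix n K).map (algebraMap (CoordRing n K) (SLFunctionField n K))

theorem det_ratMatrix : (ratMatrix n K).det = 1 := by
  have h := (algebraMap (CoordRing n K) (SLFunctionField n K)).map_det (genericMatrix n K)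
  rw [det_genericMatrix, map_one] at h
  exact h.symm

theorem JRat_eq_JValue (i j : Fin n) : JRat K i j = JValue (ratMatrix n K) i j :=
  mk_J (algebraMap (CoordRing n K) (SLFunctionField n K)) i j

theorem JRat_ne_zero {i j : Fin n} (hij : j.rev ≤ i) : JRat K i j ≠ 0 := by
  obtain ⟨Z, hdet, hZ⟩ := exists_det_stackedMatrix_ne_zero (K := K) hij
  rw [JRat]
  intro h0
  rw [FaithfulSMul.algebraMap_eq_zero_iff] at h0
  have h := mk_J (evalAt (K := K) Z hdet).toRingHom i j
  rw [h0, map_zero, JValue_of_ge _ hij] at h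
  apply hZ
  rw [h]
  congr 2
  ext a b
  exact (evalAt_genericMatrix Z hdet a b).symm

theorem evalAt_ratMatrix (a : CoordRing n K) :
    evalAt (ratMatrix n K) det_ratMatrix a =
      algebraMap (CoordRing n K) (SLFunctionField n K) a := by
  have : evalAt (ratMatrix n K) det_ratMatrix =
      IsScalarTower.toAlgHom K (CoordRing n K) (SLFunctionField n K) := by
    apply algHom_ext'
    intro i j
    rw [evalAt_genericMatrix]
    rfl
  rw [this]
  rfl

theorem conjRat_algebraMap (g : SpecialLinearGroup (Fin n) K) (a : CoordRing n K) :
    conjRat g (algebraMap (CoordRing n K) (SLFunctionField n K) a) =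
      algebraMap (CoordRing n K) (SLFunctionField n K) (conjAut g a) :=
  IsFractionRing.fieldEquivOfAlgEquiv_algebraMap K _ _ (conjAut g) a

theorem mem_invariantField_iff {c : Composition n} {f : SLFunctionField n K} :
    f ∈ invariantField K c ↔ ∀ g ∈ unipotentRadical K c, conjRat g f = f := by
  rw [invariantField, IntermediateField.mem_fixedField_iff]
  constructor
  · intro h g hg
    exact h _ (Subgroup.mem_map_of_mem _ hg)
  · rintro h _ ⟨g, hg, rfl⟩
    exact h g hg

theorem JRat_mem_invariantField {c : Composition n} {i j : Fin n} (hij : (i, j) ∈ positions c) :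
    JRat K i j ∈ invariantField K c := by
  rw [mem_invariantField_iff]
  intro g hg
  rw [JRat, conjRat_algebraMap]
  congr 1
  have h1 := mk_J (conjAut g : CoordRing n K →+* CoordRing n K) i j
  have h2 := mk_J (RingHom.id (CoordRing n K)) i j
  have h3 : (genericMatrix n K).map (conjAut g : CoordRing n K →+* CoordRing n K) =
      conjMatrix g := by
    ext s t
    exact conjAut_genericMatrix g s t
  have h4 : (genericMatrix n K).map (RingHom.id (CoordRing n K)) = genericMatrix n K := by
    ext s t
    rfl
  rw [h3] at h1
  rw [h4] at h2
  refine h1.trans (Eq.trans ?_ h2.symm)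
  rw [conjMatrix]
  refine JValue_conj (index_monotone c) ?_ ?_ _ hij
  · rw [← Matrix.map_mul]
    have : ((g⁻¹ : SpecialLinearGroup (Fin n) K) : Matrix (Fin n) (Fin n) K) *
        (g : Matrix (Fin n) (Fin n) K) = 1 := congrArg Subtype.val (inv_mul_cancel g)
    rw [this]
    simp
  · intro s t hst
    rw [Matrix.map_apply, hg s t hst]
    by_cases h : s = t <;> simp [one_apply, h]

end rational

/-! ## Density of the rational points of the unipotent radical -/

section density

variable {n : ℕ} {K : Type*} [Field K]

/-- The block unitriangular matrix with given entries above the blocks. -/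
def unipotentOf {α R : Type*} [LinearOrder α] [Zero R] [One R] (b : Fin n → α)
    (y : Fin n × Fin n → R) : Matrix (Fin n) (Fin n) R :=
  Matrix.of fun s t => if b t ≤ b s then (1 : Matrix (Fin n) (Fin n) R) s t else y (s, t)

theorem unipotentOf_apply_of_le {α R : Type*} [LinearOrder α] [Zero R] [One R] {b : Fin n → α}
    (y : Fin n × Fin n → R) (s t : Fin n) (h : b t ≤ b s) :
    unipotentOf b y s t = (1 : Matrix (Fin n) (Fin n) R) s t := if_pos h

theorem unipotentOf_entries {α R : Type*} [LinearOrder α] [Zero R] [One R] {b : Fin n → α}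
    {W : Matrix (Fin n) (Fin n) R}
    (hW : ∀ s t, b t ≤ b s → W s t = (1 : Matrix (Fin n) (Fin n) R) s t) :
    unipotentOf b (fun p => W p.1 p.2) = W := by
  ext s t
  rw [unipotentOf, of_apply]
  split_ifs with h
  · exact (hW s t h).symm
  · rfl

theorem map_unipotentOf {α R S : Type*} [LinearOrder α] [CommRing R] [CommRing S] (f : R →+* S)
    (b : Fin n → α) (y : Fin n × Fin n → R) :
    (unipotentOf b y).map f = unipotentOf b (f ∘ y) := by
  ext s t
  simp only [unipotentOf, Matrix.map_apply, of_apply]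
  split_ifs
  · by_cases h : s = t <;> simp [one_apply, h]
  · rfl

theorem det_conj_eq_one {R : Type*} [CommRing R] {X W W' : Matrix (Fin n) (Fin n) R}
    (hX : X.det = 1) (hW : W' * W = 1) : (W' * X * W).det = 1 := by
  have h := congrArg Matrix.det hW
  rw [det_mul, det_one] at h
  rw [det_mul, det_mul, hX, mul_one, h]

theorem evalAt_congr {R : Type*} [CommRing R] [Algebra K R] {M N : Matrix (Fin n) (Fin n) R}
    (h : M = N) (hM : M.det = 1) (hN : N.det = 1) (a : CoordRing n K) :
    evalAt M hM a = evalAt N hN a := by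
  subst h
  rfl

theorem algHom_evalAt {R S : Type*} [CommRing R] [Algebra K R] [CommRing S] [Algebra K S]
    (f : R →ₐ[K] S) {M : Matrix (Fin n) (Fin n) R} (hM : M.det = 1) (hfM : (M.map f).det = 1)
    (a : CoordRing n K) : f (evalAt M hM a) = evalAt (M.map f) hfM a := by
  have : f.comp (evalAt M hM) = evalAt (M.map f) hfM := by
    apply algHom_ext'
    intro i j
    rw [AlgHom.comp_apply, evalAt_genericMatrix, evalAt_genericMatrix, Matrix.map_apply]
  rw [← this]
  rfl

theorem evalAt_conjAut {R : Type*} [CommRing R] [Algebra K R] {X W' : Matrix (Fin n) (Fin n) R}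
    (hX : X.det = 1) (g : SpecialLinearGroup (Fin n) K)
    (hW : W' * (g : Matrix (Fin n) (Fin n) K).map (algebraMap K R) = 1) (a : CoordRing n K) :
    evalAt X hX (conjAut g a) =
      evalAt (W' * X * (g : Matrix (Fin n) (Fin n) K).map (algebraMap K R))
        (det_conj_eq_one hX hW) a := by
  have hinv : ((g⁻¹ : SpecialLinearGroup (Fin n) K) : Matrix (Fin n) (Fin n) K).map
      (algebraMap K R) = W' := by
    have h1 : (g : Matrix (Fin n) (Fin n) K) *
        ((g⁻¹ : SpecialLinearGroup (Fin n) K) : Matrix (Fin n) (Fin n) K) = 1 :=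
      congrArg Subtype.val (mul_inv_cancel g)
    have h2 := congrArg (fun A : Matrix (Fin n) (Fin n) K => A.map (algebraMap K R)) h1
    simp only [Matrix.map_mul] at h2
    rw [Matrix.map_one _ (map_zero _) (map_one _)] at h2
    calc _ = W' * (g : Matrix (Fin n) (Fin n) K).map (algebraMap K R) * _ := by
            rw [hW, one_mul]
      _ = W' := by rw [Matrix.mul_assoc, h2, mul_one]
  have : (evalAt (K := K) X hX).comp (conjAut g : CoordRing n K →ₐ[K] CoordRing n K) =
      evalAt _ (det_conj_eq_one hX hW) := by
    apply algHom_ext'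
    intro i j
    rw [evalAt_genericMatrix, AlgHom.comp_apply]
    have h1 : (conjAut g : CoordRing n K →ₐ[K] CoordRing n K) (genericMatrix n K i j) =
        conjMatrix g i j := conjAut_genericMatrix g i j
    rw [h1]
    have h2 : ((conjMatrix g).map (evalAt (K := K) X hX)) =
        W' * X * (g : Matrix (Fin n) (Fin n) K).map (algebraMap K R) := by
      have hc : ∀ A : Matrix (Fin n) (Fin n) K,
          (A.map (algebraMap K (CoordRing n K))).map (evalAt (K := K) X hX) =
            A.map (algebraMap K R) := by
        intro A
        ext s t
        simp only [Matrix.map_apply, AlgHom.commutes]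
      have hg : (genericMatrix n K).map (evalAt (K := K) X hX) = X := by
        ext s t
        rw [Matrix.map_apply, evalAt_genericMatrix]
      rw [conjMatrix, Matrix.map_mul, Matrix.map_mul, hc, hc, hg, hinv]
    rw [← h2, Matrix.map_apply]
  rw [← this]
  rfl

variable {F : Type*} [Field F] [Algebra K F]

/-- The generic block unitriangular matrix has determinant one, so its inverse is its adjugate and
the conjugate has polynomial entries. -/
theorem exists_mvPolynomial_evalAt_conj {α : Type*} [LinearOrder α] {b : Fin n → α}
    (hb : Monotone b) {X : Matrix (Fin n) (Fin n) F} (hX : X.det = 1) (a : CoordRing n K) :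
    ∃ p : MvPolynomial (Fin n × Fin n) F, ∀ (y : Fin n × Fin n → F)
      (W' : Matrix (Fin n) (Fin n) F) (hW : W' * unipotentOf b y = 1),
      MvPolynomial.eval y p =
        evalAt (W' * X * unipotentOf b y) (det_conj_eq_one hX hW) a := by
  let G : Matrix (Fin n) (Fin n) (MvPolynomial (Fin n × Fin n) F) :=
    unipotentOf b MvPolynomial.X
  have hG : G.det = 1 := det_eq_one_of_upperUnitriangular fun s t hst =>
    unipotentOf_apply_of_le _ s t (hb hst)
  have hGG : G.adjugate * G = 1 := by rw [adjugate_mul, hG, one_smul]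
  have hC : (X.map (MvPolynomial.C : F →+* MvPolynomial (Fin n × Fin n) F)).det = 1 := by
    have := (MvPolynomial.C : F →+* MvPolynomial (Fin n × Fin n) F).map_det X
    rw [hX, map_one] at this
    exact this.symm
  refine ⟨evalAt (G.adjugate * X.map MvPolynomial.C * G) (det_conj_eq_one hC hGG) a, ?_⟩
  intro y W' hW
  let f : MvPolynomial (Fin n × Fin n) F →ₐ[K] F := (MvPolynomial.aeval y).restrictScalars K
  have hf : ∀ p, f p = MvPolynomial.eval y p := fun p => by
    simp [f, MvPolynomial.aeval_eq_eval]
  have hfG : G.map f = unipotentOf b y := by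
    have h := map_unipotentOf f.toRingHom b (MvPolynomial.X (R := F))
    have h2 : f.toRingHom ∘ MvPolynomial.X (R := F) = y := by
      funext p
      change f _ = _
      rw [hf, MvPolynomial.eval_X]
    rw [h2] at h
    exact h
  have hfX : (X.map MvPolynomial.C).map f = X := by
    ext s t
    rw [Matrix.map_apply, Matrix.map_apply, hf, MvPolynomial.eval_C]
  have hfG' : G.adjugate.map f = W' := by
    have h1 := congrArg (fun A : Matrix (Fin n) (Fin n) _ => A.map f) hGG
    simp only [Matrix.map_mul] at h1
    rw [Matrix.map_one _ (map_zero _) (map_one _), hfG] at h1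
    have h2 : unipotentOf b y * W' = 1 := mul_eq_one_comm.mp hW
    calc G.adjugate.map f = G.adjugate.map f * (unipotentOf b y * W') := by rw [h2, mul_one]
      _ = W' := by rw [← Matrix.mul_assoc, h1, one_mul]
  have hmap : (G.adjugate * X.map MvPolynomial.C * G).map f = W' * X * unipotentOf b y := by
    rw [Matrix.map_mul, Matrix.map_mul, hfG, hfX, hfG']
  rw [← hf, algHom_evalAt f _ (by rw [hmap]; exact det_conj_eq_one hX hW)]
  exact evalAt_congr hmap _ _ a

/-- Zariski density: both sides are polynomials in the entries of the conjugating matrix, and they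
agree whenever these entries lie in the infinite subset `K` of `F`. Hence they agree at `W`. -/
theorem evalAt_conj_eq_of_forall_unipotentRadical [Infinite K] (c : Composition n)
    {X : Matrix (Fin n) (Fin n) F} (hX : X.det = 1) (a b : CoordRing n K) (r s : F)
    (h : ∀ g ∈ unipotentRadical K c,
      evalAt X hX (conjAut g a) * r = evalAt X hX (conjAut g b) * s)
    {W W' : Matrix (Fin n) (Fin n) F} (hW' : W' * W = 1)
    (hW : ∀ s t, c.index t ≤ c.index s → W s t = (1 : Matrix (Fin n) (Fin n) F) s t) :
    evalAt (W' * X * W) (det_conj_eq_one hX hW') a * r =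
      evalAt (W' * X * W) (det_conj_eq_one hX hW') b * s := by
  obtain ⟨p, hp⟩ := exists_mvPolynomial_evalAt_conj (index_monotone c) hX a
  obtain ⟨q, hq⟩ := exists_mvPolynomial_evalAt_conj (index_monotone c) hX b
  have key : p * MvPolynomial.C r = q * MvPolynomial.C s := by
    apply MvPolynomial.funext_set (fun _ => Set.range (algebraMap K F))
    · intro _
      exact Set.infinite_range_of_injective (algebraMap K F).injective
    · intro x hx
      choose y hy using fun i => hx i (Set.mem_univ i)
      obtain rfl : algebraMap K F ∘ y = x := funext hy
      have hdet : (unipotentOf c.index y).det = 1 :=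
        det_eq_one_of_upperUnitriangular fun s t hst =>
          unipotentOf_apply_of_le _ s t (index_monotone c hst)
      let g : SpecialLinearGroup (Fin n) K := ⟨unipotentOf c.index y, hdet⟩
      have hg : g ∈ unipotentRadical K c := fun s t hst => unipotentOf_apply_of_le _ s t hst
      have hgy : (g : Matrix (Fin n) (Fin n) K).map (algebraMap K F) =
          unipotentOf c.index (algebraMap K F ∘ y) := map_unipotentOf _ _ _
      have hdet' : ((g : Matrix (Fin n) (Fin n) K).map (algebraMap K F)).det = 1 := by
        have := (algebraMap K F).map_det (g : Matrix (Fin n) (Fin n) K)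
        rw [g.det_coe, map_one] at this
        exact this.symm
      have hinv : ((g : Matrix (Fin n) (Fin n) K).map (algebraMap K F)).adjugate *
          (g : Matrix (Fin n) (Fin n) K).map (algebraMap K F) = 1 := by
        rw [adjugate_mul, hdet', one_smul]
      have h1 := h g hg
      rw [evalAt_conjAut hX g hinv, evalAt_conjAut hX g hinv] at h1
      rw [map_mul, map_mul, MvPolynomial.eval_C, MvPolynomial.eval_C,
        hp _ _ (by rw [← hgy]; exact hinv), hq _ _ (by rw [← hgy]; exact hinv)]
      simp only [hgy] at h1 ⊢
      exact h1
  have hWe := unipotentOf_entries hW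
  have h1 := congrArg (MvPolynomial.eval fun p : Fin n × Fin n => W p.1 p.2) key
  rw [map_mul, map_mul, MvPolynomial.eval_C, MvPolynomial.eval_C,
    hp _ W' (by rw [hWe]; exact hW'), hq _ W' (by rw [hWe]; exact hW')] at h1
  simp only [hWe] at h1
  exact h1

theorem evalAt_mem (L : IntermediateField K F) {M : Matrix (Fin n) (Fin n) F} (hM : M.det = 1)
    (hL : ∀ i j, M i j ∈ L) (a : CoordRing n K) : evalAt M hM a ∈ L := by
  let M' : Matrix (Fin n) (Fin n) L := Matrix.of fun i j => ⟨M i j, hL i j⟩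
  have hmap : M'.map L.val = M := rfl
  have hM' : M'.det = 1 := by
    apply L.val.injective
    rw [map_one, ← hM, ← hmap]
    exact L.val.toRingHom.map_det M'
  have h := algHom_evalAt L.val hM' (by rw [hmap]; exact hM) a
  rw [evalAt_congr hmap _ hM] at h
  rw [← h]
  exact (evalAt M' hM' a).2

/-- Density transports the identity `f * b = a` from `X` to the conjugate `W' X W`, which expresses
`f` as a quotient of values in `L`. -/
theorem invariantField_le_of_conj_mem [Infinite K] {c : Composition n}
    (L : IntermediateField K (SLFunctionField n K))
    {W W' : Matrix (Fin n) (Fin n) (SLFunctionField n K)} (hW' : W' * W = 1)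
    (hW : ∀ s t, c.index t ≤ c.index s →
      W s t = (1 : Matrix (Fin n) (Fin n) (SLFunctionField n K)) s t)
    (hL : ∀ i j, (W' * ratMatrix n K * W) i j ∈ L) : invariantField K c ≤ L := by
  intro f hf
  rw [mem_invariantField_iff] at hf
  have hWW : W * W' = 1 := mul_eq_one_comm.mp hW'
  have hW2 := blockUnitriangular_of_mul_eq_one hWW hW
  have hZ := det_conj_eq_one det_ratMatrix hW'
  obtain ⟨a, b, hb, hab⟩ := IsFractionRing.div_surjective (A := CoordRing n K) f
  have hb0 : b ≠ 0 := nonZeroDivisors.ne_zero hb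
  have hinj := FaithfulSMul.algebraMap_injective (CoordRing n K) (SLFunctionField n K)
  -- The denominator might vanish at `W' X W`, so it is replaced by a translate. If all translates
  -- vanished there, density applied to the inverse conjugation would give `b = 0`.
  obtain ⟨g, hg, hgb⟩ : ∃ g ∈ unipotentRadical K c,
      evalAt (W' * ratMatrix n K * W) hZ (conjAut g b) ≠ 0 := by
    by_contra! hall
    have h := evalAt_conj_eq_of_forall_unipotentRadical c hZ b 0 1 1
      (fun g hg => by rw [hall g hg, map_zero, map_zero]) hWW hW2
    rw [map_zero, zero_mul, mul_one] at h
    have hX : W * (W' * ratMatrix n K * W) * W' = ratMatrix n K := by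
      calc _ = (W * W') * ratMatrix n K * (W * W') := by simp only [Matrix.mul_assoc]
        _ = _ := by rw [hWW, one_mul, mul_one]
    rw [evalAt_congr hX _ det_ratMatrix, evalAt_ratMatrix] at h
    exact hb0 (hinj (h.trans (map_zero _).symm))
  have hmul : ∀ h ∈ unipotentRadical K c, f * algebraMap _ _ (conjAut h b) =
      algebraMap (CoordRing n K) (SLFunctionField n K) (conjAut h a) := by
    intro h hh
    have h1 : f * algebraMap _ _ b = algebraMap (CoordRing n K) (SLFunctionField n K) a := by
      rw [← hab, div_mul_cancel₀]
      exact fun h0 => hb0 (hinj (h0.trans (map_zero _).symm))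
    have h2 := congrArg (conjRat h) h1
    rwa [map_mul, hf h hh, conjRat_algebraMap, conjRat_algebraMap] at h2
  have h := evalAt_conj_eq_of_forall_unipotentRadical c det_ratMatrix (conjAut g b) (conjAut g a)
    f 1 (fun h hh => by
      rw [evalAt_ratMatrix, evalAt_ratMatrix, mul_one, ← AlgEquiv.mul_apply, ← map_mul,
        ← AlgEquiv.mul_apply, ← map_mul, mul_comm]
      exact hmul _ (mul_mem hh hg)) hW' hW
  rw [mul_one, mul_comm] at h
  rw [eq_div_of_mul_eq hgb h]
  exact div_mem (evalAt_mem L hZ hL _) (evalAt_mem L hZ hL _)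

end density

/-! ## Algebraic independence -/

section algebraicIndependence

variable {n : ℕ} {K : Type*} [Field K]

-- The family `x` bounds the transcendence degree below by the size of `ι`, and a generating family
-- of that finite size must be a transcendence basis.
open scoped IntermediateField.algebraAdjoinAdjoin in
theorem algebraicIndependent_of_adjoin_eq_top {E ι : Type*} [Field E] [Algebra K E] [Finite ι]
    {x y : ι → E} (hx : AlgebraicIndependent K x)
    (hy : IntermediateField.adjoin K (Set.range y) = ⊤) : AlgebraicIndependent K y := by
  have h1 : Algebra.IsAlgebraic (IntermediateField.adjoin K (Set.range y)) E := by
    rw [hy]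
    infer_instance
  have h2 : Algebra.IsAlgebraic (Algebra.adjoin K (Set.range y)) E :=
    (IsFractionRing.comap_isAlgebraic_iff (A := Algebra.adjoin K (Set.range y))
      (K := IntermediateField.adjoin K (Set.range y)) (C := E)).mpr h1
  exact (Algebra.IsAlgebraic.isTranscendenceBasis_of_lift_le_trdeg_of_finite K y hx.lift_cardinalMk_le_trdeg).1

theorem SLFunctionField.intermediateField_eq_top (L : IntermediateField K (SLFunctionField n K))
    (hL : ∀ i j, ratMatrix n K i j ∈ L) : L = ⊤ := by
  rw [eq_top_iff]
  rintro f -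
  obtain ⟨a, b, -, rfl⟩ := IsFractionRing.div_surjective (A := CoordRing n K) f
  rw [← evalAt_ratMatrix, ← evalAt_ratMatrix]
  exact div_mem (evalAt_mem L _ hL _) (evalAt_mem L _ hL _)

/-- The matrix which multiplies the first row by `t`. -/
def scaleFirst {R : Type*} [CommRing R] [NeZero n] (t : R) (X : Matrix (Fin n) (Fin n) R) :
    Matrix (Fin n) (Fin n) R :=
  Matrix.of fun i j => (if i = 0 then t else 1) * X i j

theorem map_scaleFirst {R S : Type*} [CommRing R] [CommRing S] [NeZero n] (f : R →+* S) (t : R)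
    (X : Matrix (Fin n) (Fin n) R) : (scaleFirst t X).map f = scaleFirst (f t) (X.map f) := by
  ext i j
  simp only [scaleFirst, Matrix.map_apply, of_apply, map_mul]
  split_ifs <;> simp

theorem det_scaleFirst {R : Type*} [CommRing R] [NeZero n] (t : R)
    (X : Matrix (Fin n) (Fin n) R) : (scaleFirst t X).det = t * X.det := by
  have h := det_mul_column (fun i : Fin n => if i = 0 then t else 1) X
  rw [Finset.prod_ite_eq' Finset.univ (0 : Fin n), if_pos (Finset.mem_univ _)] at h
  exact h

open Polynomial in
/-- With a further variable for the determinant, the coordinates on `SL(n)` become coordinates on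
`GL(n)`. -/
theorem algebraicIndependent_scaleFirst [NeZero n] :
    AlgebraicIndependent K (fun p : Fin n × Fin n =>
      scaleFirst (Polynomial.X : (CoordRing n K)[X]) ((genericMatrix n K).map Polynomial.C)
        p.1 p.2) := by
  let P := MvPolynomial (Fin n × Fin n) K
  let E := FractionRing P
  let Y : Matrix (Fin n) (Fin n) E := (mvPolynomialX (Fin n) (Fin n) K).map (algebraMap P E)
  have hY : Y.det ≠ 0 := by
    have h : algebraMap P E (mvPolynomialX (Fin n) (Fin n) K).det = Y.det :=
      (algebraMap P E).map_det _
    rw [← h, Ne, FaithfulSMul.algebraMap_eq_zero_iff]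
    exact det_mvPolynomialX_ne_zero (Fin n) K
  have hM : (scaleFirst Y.det⁻¹ Y).det = 1 := by rw [det_scaleFirst, inv_mul_cancel₀ hY]
  let e : CoordRing n K →ₐ[K] E := evalAt _ hM
  -- The new variable goes to `det Y`, and the first row of the generic matrix to that of `Y`
  -- divided by `det Y`, so `f` maps the family to the independent variables.
  let f : (CoordRing n K)[X] →ₐ[K] E := Polynomial.eval₂AlgHom e Y.det fun _ => Commute.all _ _
  have hfX : f Polynomial.X = Y.det := by simp [f]
  have hfC : ∀ a, f (Polynomial.C a) = e a := fun a => by simp [f]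
  apply AlgebraicIndependent.of_comp f
  have hcomp : (f ∘ fun p : Fin n × Fin n =>
      scaleFirst (Polynomial.X : (CoordRing n K)[X]) ((genericMatrix n K).map Polynomial.C)
        p.1 p.2) = IsScalarTower.toAlgHom K P E ∘ MvPolynomial.X := by
    funext p
    have h1 := congrFun (congrFun (map_scaleFirst f.toRingHom (Polynomial.X)
      ((genericMatrix n K).map Polynomial.C)) p.1) p.2
    have h2 : f.toRingHom Polynomial.X = Y.det := hfX
    have h3 : ((genericMatrix n K).map Polynomial.C).map f.toRingHom = scaleFirst Y.det⁻¹ Y := by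
      ext i j
      exact (hfC _).trans (evalAt_genericMatrix _ hM i j)
    rw [h2, h3] at h1
    refine h1.trans ?_
    simp only [scaleFirst, of_apply]
    rw [← mul_assoc]
    have h4 : Y p.1 p.2 = algebraMap P E (MvPolynomial.X p) := rfl
    rw [h4]
    split_ifs
    · rw [mul_inv_cancel₀ hY, one_mul]
      rfl
    · rw [one_mul, one_mul]
      rfl
  rw [hcomp]
  exact (MvPolynomial.algebraicIndependent_X _ K).map'
    (FaithfulSMul.algebraMap_injective P E)

open Polynomial in
/-- `n ^ 2 - 1` generators of the field of rational functions on `SL(n)`, indexed by the positions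
other than `o`, are algebraically independent. -/
theorem algebraicIndependent_of_adjoin_image_compl_eq_top [NeZero n] (o : Fin n × Fin n)
    (v : Fin n × Fin n → SLFunctionField n K)
    (hv : IntermediateField.adjoin K (v '' {o}ᶜ) = ⊤) :
    AlgebraicIndependent K (fun p : {p : Fin n × Fin n // p ≠ o} => v p) := by
  let F := SLFunctionField n K
  let E := FractionRing F[X]
  let ι : F →ₐ[K] E := (IsScalarTower.toAlgHom K F[X] E).comp (Polynomial.CAlgHom (R := K) (A := F))
  let t : E := algebraMap F[X] E Polynomial.X
  let j : (CoordRing n K)[X] →ₐ[K] E := (IsScalarTower.toAlgHom K F[X] E).comp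
    (Polynomial.mapAlgHom (IsScalarTower.toAlgHom K (CoordRing n K) F))
  have hj : Function.Injective j := by
    refine (FaithfulSMul.algebraMap_injective F[X] E).comp ?_
    exact Polynomial.map_injective _ (FaithfulSMul.algebraMap_injective (CoordRing n K) F)
  have hind := algebraicIndependent_scaleFirst (n := n) (K := K) |>.map' hj
  -- The new variable fills the omitted slot `o`. This gives `n²` generators of a field that
  -- contains `n²` independent elements.
  let w : Fin n × Fin n → E := Function.update (ι ∘ v) o t
  have hw : IntermediateField.adjoin K (Set.range w) = ⊤ := by
    set L := IntermediateField.adjoin K (Set.range w)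
    have ht : t ∈ L := IntermediateField.subset_adjoin _ _ ⟨o, by simp [w]⟩
    have hF : ∀ f : F, ι f ∈ L := by
      intro f
      have hle : IntermediateField.adjoin K (v '' {o}ᶜ) ≤ L.comap ι := by
        rw [IntermediateField.adjoin_le_iff]
        rintro _ ⟨p, hp, rfl⟩
        refine IntermediateField.subset_adjoin _ _ ⟨p, ?_⟩
        simp only [w, Function.update_of_ne (show p ≠ o from hp)]
        rfl
      rw [hv] at hle
      exact hle (IntermediateField.mem_top (x := f))
    have hpoly : ∀ p : F[X], algebraMap F[X] E p ∈ L := by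
      intro p
      induction p using Polynomial.induction_on' with
      | add p q hp hq => rw [map_add]; exact add_mem hp hq
      | monomial k a =>
        rw [← Polynomial.C_mul_X_pow_eq_monomial, map_mul, map_pow]
        exact mul_mem (hF a) (pow_mem ht k)
    rw [eq_top_iff]
    rintro x -
    obtain ⟨a, b, -, rfl⟩ := IsFractionRing.div_surjective (A := F[X]) x
    exact div_mem (hpoly a) (hpoly b)
  have h := algebraicIndependent_of_adjoin_eq_top hind hw
  have h' := h.comp (Subtype.val : {p : Fin n × Fin n // p ≠ o} → _) Subtype.val_injective
  apply AlgebraicIndependent.of_comp ι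
  have hcomp : w ∘ (Subtype.val : {p : Fin n × Fin n // p ≠ o} → _) = ι ∘ fun p => v p.val := by
    funext p
    simp only [Function.comp_apply, w, Function.update_of_ne p.2]
  rwa [hcomp] at h'

end algebraicIndependence

theorem J_zero_rev_zero (K : Type*) [Field K] (n : ℕ) [NeZero n] :
    J K (0 : Fin n) (Fin.rev 0) = (mvPolynomialX (Fin n) (Fin n) K).det :=
  JValue_zero_rev_zero (mvPolynomialX (Fin n) (Fin n) K)

theorem JRat_zero_rev_zero (K : Type*) [Field K] (n : ℕ) [NeZero n] :
    JRat K (0 : Fin n) (Fin.rev 0) = 1 := by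
  rw [JRat_eq_JValue, JValue_zero_rev_zero, det_ratMatrix]

end UnipotentInvariants

/-! ### Generation and independence of the invariants -/

open UnipotentInvariants in
theorem mainTheorem2 (K : Type*) [Field K] [CharZero K] (n : ℕ) [NeZero n] (c : Composition n) :
    AlgebraicIndependent K
      (fun p : {p : Fin n × Fin n //
          p ∈ UnipotentInvariants.positions c ∧ p ≠ (0, Fin.rev 0)} =>
        UnipotentInvariants.JRat K p.val.1 p.val.2) ∧
    IntermediateField.adjoin K
      (Set.range fun p : {p : Fin n × Fin n //
          p ∈ UnipotentInvariants.positions c ∧ p ≠ (0, Fin.rev 0)} =>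
        UnipotentInvariants.JRat K p.val.1 p.val.2) =
      UnipotentInvariants.invariantField K c ∧
    ((0 : Fin n), Fin.rev 0) ∈ UnipotentInvariants.positions c ∧
    UnipotentInvariants.J K (0 : Fin n) (Fin.rev 0) =
      (Matrix.mvPolynomialX (Fin n) (Fin n) K).det := by
  set L := IntermediateField.adjoin K
      (Set.range fun p : {p : Fin n × Fin n //
          p ∈ UnipotentInvariants.positions c ∧ p ≠ (0, Fin.rev 0)} =>
        UnipotentInvariants.JRat K p.val.1 p.val.2) with hLdef
  have hJL : ∀ i j : Fin n, (i, j) ∈ positions c → JRat K i j ∈ L := by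
    intro i j hij
    by_cases h : (i, j) = (0, Fin.rev 0)
    · obtain ⟨rfl, rfl⟩ := Prod.mk.inj h
      rw [JRat_zero_rev_zero]
      exact one_mem _
    · exact IntermediateField.subset_adjoin _ _ ⟨⟨(i, j), hij, h⟩, rfl⟩
  obtain ⟨W, W', hW', hW, hZ⟩ := exists_blockUnitriangular_conj_mem (index_monotone c)
    L.toSubfield (X := ratMatrix n K) det_ratMatrix
    (fun i j hij hb => by
      rw [← JValue_of_le _ hij, ← JRat_eq_JValue]
      exact hJL i j hb)
    (fun i j hij => by
      rw [← JValue_of_ge _ hij, ← JRat_eq_JValue]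
      exact hJL i j (index_monotone c hij))
    (fun i j hij => by
      rw [← JValue_of_ge _ hij, ← JRat_eq_JValue]
      exact JRat_ne_zero hij)
  refine ⟨?_, le_antisymm ?_ ?_, ?_, J_zero_rev_zero K n⟩
  · classical
    -- The positions outside `positions c` are, after reflecting the column, exactly those above the
    -- blocks, so the free entries of `W` complete the `J_ij` to a family on all positions.
    let v : Fin n × Fin n → SLFunctionField n K := fun p =>
      if p ∈ positions c then JRat K p.1 p.2 else W p.1 p.2.rev
    have hv : IntermediateField.adjoin K (v '' {((0 : Fin n), Fin.rev 0)}ᶜ) = ⊤ := by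
      set M := IntermediateField.adjoin K (v '' {((0 : Fin n), Fin.rev 0)}ᶜ)
      have hLM : L ≤ M := by
        rw [hLdef, IntermediateField.adjoin_le_iff]
        rintro _ ⟨p, rfl⟩
        refine IntermediateField.subset_adjoin _ _ ⟨p.1, p.2.2, ?_⟩
        simp only [v, if_pos p.2.1]
      have hWM : ∀ s t, W s t ∈ M := by
        intro s t
        by_cases h : c.index t ≤ c.index s
        · rw [hW s t h, Matrix.one_apply]
          split_ifs
          · exact one_mem _
          · exact zero_mem _
        · refine IntermediateField.subset_adjoin _ _ ⟨(s, t.rev), ?_, ?_⟩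
          · intro h0
            obtain ⟨rfl, h1⟩ := Prod.mk.inj h0
            obtain rfl := Fin.rev_injective h1
            exact h le_rfl
          · have h1 : (s, t.rev) ∉ positions c := by
              simpa [positions] using h
            simp only [v, if_neg h1, Fin.rev_rev]
      have hWdet : W.det = 1 := det_eq_one_of_upperUnitriangular fun s t hst =>
        hW s t (index_monotone c hst)
      have hWadj : W * W.adjugate = 1 := by rw [Matrix.mul_adjugate, hWdet, one_smul]
      have hWW : W * W' = 1 := mul_eq_one_comm.mp hW'
      apply SLFunctionField.intermediateField_eq_top
      have hX : ratMatrix n K = W * (W' * ratMatrix n K * W) * W.adjugate := by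
        calc ratMatrix n K = (W * W') * ratMatrix n K * (W * W.adjugate) := by
              rw [hWW, hWadj, one_mul, mul_one]
          _ = _ := by simp only [Matrix.mul_assoc]
      rw [hX]
      exact mul_mem_subfield M.toSubfield (mul_mem_subfield M.toSubfield hWM
        fun i j => hLM (hZ i j)) (adjugate_mem_subfield M.toSubfield hWM)
    have h := algebraicIndependent_of_adjoin_image_compl_eq_top _ v hv
    have h' := h.comp (fun p : {p : Fin n × Fin n //
      p ∈ positions c ∧ p ≠ (0, Fin.rev 0)} => ⟨p.1, p.2.2⟩) fun p q hpq =>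
        Subtype.ext (Subtype.mk.inj hpq)
    convert h' using 1
    funext p
    simp only [Function.comp_apply, v, if_pos p.2.1]
  · rw [IntermediateField.adjoin_le_iff]
    rintro _ ⟨p, rfl⟩
    exact JRat_mem_invariantField p.2.1
  · exact invariantField_le_of_conj_mem L hW' hW hZ
  · simp [positions]
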